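/- **Setting.** A *classical oracle* with interface $\mathrm{len}:\{0,1\}^*\to\mathbb N$ is a function $O$ that assigns to each $x\in\{0,1\}^*$ an answer $O(x)\in\{0,1\}^{\mathrm{len}(x)}$. *Non-collapsing measurement oracle.* An oracle-aided circuit $C=(C_1,M_1,\dots,C_T,M_T)$ on $l$ qubits consists of quantum circuits $C_i$ over the gate set $\{X,H,T,\mathrm{CNOT}\}$, each followed by at most one quantum query to the oracle (an XOR query $|x\rangle|y\rangle\mapsto|x\rangle|y\oplus O(x)\rangle$ or a phase query $|x\rangle|y\rangle\mapsto(-1)^{y\cdot O(x)}|x\rangle|y\rangle$; answer bits beyond the length of the response register are dropped, missing ones are $0$), and of computational-basis measurements $M_i$ of some of the qubits. Circuits are described by bit strings in a fixed self-delimiting encoding, in which the numbers $l$ and $T$ are at most the length of the description. For a description $C$ let $\mathsf{DQ}^O_C$ be the distribution of the string $v_1v_2\cdots v_T$ generated as follows: start with $|\psi_0\rangle=|0\cdots0\rangle$; for $i=1,\dots,T$ let $|\psi_i\rangle$ be the (random) normalized post-measurement state of applying $C_i^O$ and then the measurement $M_i$ to $|\psi_{i-1}\rangle$, and sample $v_i\in\{0,1\}^l$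 according to a computational-basis measurement of all qubits of $|\psi_i\rangle$, without collapsing $|\psi_i\rangle$. If the string $C$ is not a description of a circuit, $\mathsf{DQ}^O_C$ is the point mass on the empty string. *Compression unitary.* With $|\mathsf{DQ}^O_C\rangle=\sum_z\sqrt{\Pr_{\mathsf{DQ}^O_C}[z]}\,|z\rangle$ and an additional basis state $|\bot\rangle$, the compression unitary for $\mathsf{DQ}^O=\bigotimes_C\mathsf{DQ}^O_C$ is $$W^O=\sum_C|C\rangle\langle C|\otimes\Big(|\mathsf{DQ}^O_C\rangle\langle\bot|+|\bot\rangle\langle\mathsf{DQ}^O_C|+I-|\bot\rangle\langle\bot|-|\mathsf{DQ}^O_C\rangle\langle\mathsf{DQ}^O_C|\Big).$$ Algorithms whose queries have length at most $n$ use its restriction to strings $C$ of length at most $n$ and outcomes $z$ of length at most $n^2$ (longer outcomes do not occur). *Query algorithms.* An $n$-query algorithm makes at most $n$ queries, each of length at most $n$; if its output is a bit string, that string has length at most $n$. **Theorem.** For every interface $\mathrm{len}$ and every set $\mathbb O$ of oracles with this interface, the collection $\{W^O\}_{O\in\mathbb O}$ is OW2H-compatible for $\mathbb O$ with constant $c=1/4$.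 That is: 1. Every $O\in\mathbb O$ can be computed exactly with a single query to $W^O$: for each $k$ there is a one-query quantum algorithm, not depending on $O$, that for all $O\in\mathbb O$ and all inputs $x$ with $|x|\le k$ outputs $O(x)$ with probability $1$. 2. There are polynomials $p,r$ such that for every function $q:\mathbb N\to\mathbb N$ there is a $p(q(\lambda))$-query algorithm $\mathcal B$, with query access to a unitary family and black-box access to an adversary, such that for all $O,O'\in\mathbb O$, all $q(\lambda)$-query adversaries $\mathcal A$ and all $\lambda\in\mathbb N$, $$\big\|\,|\psi\rangle-|\psi'\rangle\,\big\|\le r(q(\lambda))\cdot\Big(\Pr\big[\mathcal B^{W^O,\mathcal A}(1^\lambda)\in\{x:O(x)\ne O'(x)\}\big]\Big)^{1/4},$$ where $|\psi\rangle$ and $|\psi'\rangle$ are the purified final states of $\mathcal A^{W^O}(1^\lambda)$ and $\mathcal A^{W^{O'}}(1^\lambda)$. -/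

import Mathlib

open scoped Kronecker

noncomputable section

namespace PDQP

/-! ### Bit strings and classical oracles -/

/-- Bit strings of length at most `n`. -/
abbrev BStr (n : ℕ) := {s : List Bool // s.length ≤ n}

instance (n : ℕ) : Fintype (BStr n) :=
  haveI : Finite (BStr n) := (List.finite_length_le Bool n).to_subtype
  Fintype.ofFinite _

/-- Classical oracles mapping bit strings to bit strings, with interface `len`:
the answer to the query `x` has `len x` bits. -/
abbrev Oracle (len : List Bool → ℕ) := (x : List Bool) → Fin (len x) → Bool

/-- The `k`-th bit of the answer `O x`, and `0` beyond the end of the answer. -/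
def ansBit {len : List Bool → ℕ} (O : Oracle len) (x : List Bool) (k : ℕ) : Bool :=
  if h : k < len x then O x ⟨k, h⟩ else false

/-! ### Oracle-aided circuits with intermediate measurements -/

/-- Elementary gates on `l` qubits: a universal gate set. -/
inductive Gate (l : ℕ) where
  | X (i : Fin l)
  | H (i : Fin l)
  | T (i : Fin l)
  | CNOT (c t : Fin l) (h : c ≠ t)

/-- A quantum query: the wires `inp` hold the query string, the wires `out` are the response
register. It is either a phase query or an ordinary (XOR) query. -/
structure Query (l : ℕ) where
  phase : Bool
  inp : List (Fin l)
  out : List (Fin l)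
  nodup : (inp ++ out).Nodup

/-- A pair `(C_i, M_i)`: gates, then at most one oracle query, then the computational-basis
measurement of the wires in `meas`. -/
structure Step (l : ℕ) where
  gates : List (Gate l)
  query : Option (Query l)
  meas : List (Fin l)

/-- A circuit `(C_1, M_1, …, C_T, M_T)` on `l` qubits. -/
structure Circuit where
  l : ℕ
  steps : List (Step l)

/-! ### Classical descriptions of circuits -/

def encNat (k : ℕ) : List Bool := List.replicate k true ++ [false]

def encList {α : Type} (f : α → List Bool) (xs : List α) : List Bool :=
  encNat xs.length ++ xs.flatMap f

def encWire {l : ℕ} (i : Fin l) : List Bool := encNat i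

def encGate {l : ℕ} : Gate l → List Bool
  | .X i => [false, false] ++ encWire i
  | .H i => [false, true] ++ encWire i
  | .T i => [true, false] ++ encWire i
  | .CNOT c t _ => [true, true] ++ (encWire c ++ encWire t)

def encQuery {l : ℕ} : Option (Query l) → List Bool
  | none => [false]
  | some Q => [true, Q.phase] ++ (encList encWire Q.inp ++ encList encWire Q.out)

def encStep {l : ℕ} (s : Step l) : List Bool :=
  encList encGate s.gates ++ (encQuery s.query ++ encList encWire s.meas)

/-- The bit string describing a circuit. -/
def Circuit.encode (C : Circuit) : List Bool := encNat C.l ++ encList encStep C.steps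

/-- Self-delimiting encodings. -/
def PrefixFree {α : Type} (f : α → List Bool) : Prop :=
  ∀ a b s t, f a ++ s = f b ++ t → a = b ∧ s = t

theorem prefixFree_encNat : PrefixFree encNat := by
  intro a
  induction a with
  | zero =>
    intro b s t h
    cases b with
    | zero => simpa [encNat] using h
    | succ b => simp [encNat, List.replicate_succ] at h
  | succ a ih =>
    intro b s t h
    cases b with
    | zero => simp [encNat, List.replicate_succ] at h
    | succ b =>
      have h2 : encNat a ++ s = encNat b ++ t := by
        simpa [encNat, List.replicate_succ] using h
      obtain ⟨h3, h4⟩ := ih b s t h2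
      exact ⟨by rw [h3], h4⟩

theorem prefixFree_encWire {l : ℕ} : PrefixFree (encWire (l := l)) := by
  intro a b s t h
  obtain ⟨h1, h2⟩ := prefixFree_encNat _ _ _ _ h
  exact ⟨Fin.ext h1, h2⟩

theorem prefixFree_encList {α : Type} {f : α → List Bool} (hf : PrefixFree f) :
    PrefixFree (encList f) := by
  have key : ∀ (a b : List α) (s t : List Bool), a.length = b.length →
      a.flatMap f ++ s = b.flatMap f ++ t → a = b ∧ s = t := by
    intro a
    induction a with
    | nil =>
      intro b s t hl h
      have hb : b = [] := List.length_eq_zero_iff.mp hl.symm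
      subst hb
      exact ⟨rfl, by simpa using h⟩
    | cons x a ih =>
      intro b s t hl h
      cases b with
      | nil => simp at hl
      | cons y b =>
        simp only [List.flatMap_cons, List.append_assoc] at h
        obtain ⟨h1, h2⟩ := hf _ _ _ _ h
        obtain ⟨h3, h4⟩ := ih b s t (by simpa using hl) h2
        exact ⟨by rw [h1, h3], h4⟩
  intro a b s t h
  simp only [encList, List.append_assoc] at h
  obtain ⟨h1, h2⟩ := prefixFree_encNat _ _ _ _ h
  exact key a b s t h1 h2

theorem prefixFree_encGate {l : ℕ} : PrefixFree (encGate (l := l)) := by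
  intro a b s t h
  cases a <;> cases b <;> simp only [encGate, List.cons_append, List.nil_append, List.append_assoc,
    List.cons.injEq, reduceCtorEq, Bool.false_eq_true, Bool.true_eq_false, true_and, false_and, and_false] at h
  case X.X i j => obtain ⟨h1, h2⟩ := prefixFree_encWire _ _ _ _ h; exact ⟨by rw [h1], h2⟩
  case H.H i j => obtain ⟨h1, h2⟩ := prefixFree_encWire _ _ _ _ h; exact ⟨by rw [h1], h2⟩
  case T.T i j => obtain ⟨h1, h2⟩ := prefixFree_encWire _ _ _ _ h; exact ⟨by rw [h1], h2⟩
  case CNOT.CNOT c t h c' t' h' =>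
    obtain ⟨h1, h2⟩ := prefixFree_encWire _ _ _ _ h
    obtain ⟨h3, h4⟩ := prefixFree_encWire _ _ _ _ h2
    subst h1 h3
    exact ⟨rfl, h4⟩

theorem prefixFree_encQuery {l : ℕ} : PrefixFree (encQuery (l := l)) := by
  intro a b s t h
  cases a with
  | none => cases b <;> simp [encQuery] at h <;> simp [h]
  | some P =>
    cases b with
    | none => simp [encQuery] at h
    | some R =>
      obtain ⟨p1, p2, p3, p4⟩ := P
      obtain ⟨r1, r2, r3, r4⟩ := R
      simp only [encQuery, List.append_assoc, List.cons_append, List.nil_append,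
        List.cons.injEq, true_and] at h
      obtain ⟨h0, h⟩ := h
      obtain ⟨h1, h2⟩ := prefixFree_encList prefixFree_encWire _ _ _ _ h
      obtain ⟨h3, h4⟩ := prefixFree_encList prefixFree_encWire _ _ _ _ h2
      subst h0 h1 h3
      exact ⟨rfl, h4⟩

theorem prefixFree_encStep {l : ℕ} : PrefixFree (encStep (l := l)) := by
  intro a b s t h
  obtain ⟨a1, a2, a3⟩ := a
  obtain ⟨b1, b2, b3⟩ := b
  simp only [encStep, List.append_assoc] at h
  obtain ⟨h1, h2⟩ := prefixFree_encList prefixFree_encGate _ _ _ _ h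
  obtain ⟨h3, h4⟩ := prefixFree_encQuery _ _ _ _ h2
  obtain ⟨h5, h6⟩ := prefixFree_encList prefixFree_encWire _ _ _ _ h4
  subst h1 h3 h5
  exact ⟨rfl, h6⟩

theorem Circuit.encode_injective : Function.Injective Circuit.encode := by
  intro a b h
  obtain ⟨l, a⟩ := a
  obtain ⟨m, b⟩ := b
  simp only [Circuit.encode] at h
  obtain ⟨h1, h2⟩ := prefixFree_encNat _ _ _ _ h
  subst h1
  obtain ⟨h3, -⟩ := prefixFree_encList prefixFree_encStep a b [] [] (by simpa using h2)
  rw [h3]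

open Classical in
/-- The circuit described by a string, if the string is a valid description. -/
def decode (s : List Bool) : Option Circuit :=
  if h : ∃ C : Circuit, C.encode = s then some h.choose else none

theorem encode_of_decode {s : List Bool} {C : Circuit} (h : decode s = some C) :
    C.encode = s := by
  classical
  unfold decode at h
  split_ifs at h with hs
  obtain rfl := Option.some.inj h
  exact hs.choose_spec

theorem decode_encode (C : Circuit) : decode C.encode = some C := by
  classical
  have hs : ∃ D : Circuit, D.encode = C.encode := ⟨C, rfl⟩
  unfold decode
  rw [dif_pos hs, Circuit.encode_injective hs.choose_spec]

theorem length_encList_le {α : Type} (f : α → List Bool) (xs : List α) :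
    xs.length ≤ (encList f xs).length := by
  simp only [encList, encNat, List.length_append, List.length_replicate]
  omega

theorem size_le_of_decode {s : List Bool} {C : Circuit} (h : decode s = some C) :
    C.l ≤ s.length ∧ C.steps.length ≤ s.length := by
  rw [← encode_of_decode h]
  have := length_encList_le encStep C.steps
  simp only [Circuit.encode, List.length_append, encNat, List.length_replicate]
  omega

/-! ### Semantics of circuits -/

/-- Computational basis of `l` qubits. -/
abbrev Qb (l : ℕ) := Fin l → Bool

/-- Flip one bit. -/
def flip {l : ℕ} (i : Fin l) (z : Qb l) : Qb l := Function.update z i (!z i)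

/-- The action of a gate on amplitudes. -/
def Gate.act {l : ℕ} : Gate l → (Qb l → ℂ) → Qb l → ℂ
  | .X i, ψ => fun z => ψ (flip i z)
  | .H i, ψ => fun z => if z i then ((√2 : ℝ) : ℂ)⁻¹ * (ψ (flip i z) - ψ z)
      else ((√2 : ℝ) : ℂ)⁻¹ * (ψ z + ψ (flip i z))
  | .T i, ψ => fun z => if z i then Complex.exp ((Real.pi / 4 : ℝ) * Complex.I) * ψ z else ψ z
  | .CNOT c t _, ψ => fun z => if z c then ψ (flip t z) else ψ z

variable {len : List Bool → ℕ}

/-- The answer bit that belongs to the wire `w` when the basis state `z` is queried. -/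
def Query.bit {l : ℕ} (O : Oracle len) (Q : Query l) (z : Qb l) (w : Fin l) : Bool :=
  if w ∈ Q.out then ansBit O (Q.inp.map z) (Q.out.idxOf w) else false

/-- `|x⟩|y⟩ ↦ |x⟩|y ⊕ O(x)⟩` on basis states. -/
def Query.xorMap {l : ℕ} (O : Oracle len) (Q : Query l) (z : Qb l) : Qb l :=
  fun w => xor (z w) (Q.bit O z w)

/-- The action of a query on amplitudes: `|x⟩|y⟩ ↦ (-1)^(y · O(x)) |x⟩|y⟩` for a phase query,
and `|x⟩|y⟩ ↦ |x⟩|y ⊕ O(x)⟩` otherwise (an involution on basis states). -/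
def Query.act {l : ℕ} (O : Oracle len) (Q : Query l) (ψ : Qb l → ℂ) : Qb l → ℂ :=
  if Q.phase then fun z => (∏ w : Fin l, if z w && Q.bit O z w then (-1 : ℂ) else 1) * ψ z
  else fun z => ψ (Q.xorMap O z)

/-- The unitary `C_i^O` of a step: its gates in order, then its query if there is one. -/
def Step.act {l : ℕ} (O : Oracle len) (s : Step l) (ψ : Qb l → ℂ) : Qb l → ℂ :=
  let φ := s.gates.foldl (fun χ g => g.act χ) ψ
  match s.query with
  | none => φ
  | some Q => Q.act O φ

/-- Squared Euclidean norm. -/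
def normSq {ι : Type} [Fintype ι] (ψ : ι → ℂ) : ℝ := ∑ z, ‖ψ z‖ ^ 2

theorem flip_flip {l : ℕ} (i : Fin l) (z : Qb l) : flip i (flip i z) = z := by
  simp [flip]

theorem normSq_comp {l : ℕ} (f : Qb l → Qb l) (hf : Function.Involutive f) (ψ : Qb l → ℂ) :
    normSq (fun z => ψ (f z)) = normSq ψ :=
  Equiv.sum_comp hf.toPerm (fun z => ‖ψ z‖ ^ 2)

theorem normSq_gate {l : ℕ} (g : Gate l) (ψ : Qb l → ℂ) : normSq (g.act ψ) = normSq ψ := by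
  cases g with
  | X i => exact normSq_comp (flip i) (flip_flip i) ψ
  | H i =>
    have h1 : ∀ χ : Qb l → ℂ, normSq χ + normSq χ =
        ∑ z, (‖χ z‖ ^ 2 + ‖χ (flip i z)‖ ^ 2) := by
      intro χ
      rw [Finset.sum_add_distrib]
      congr 1
      exact (normSq_comp (flip i) (flip_flip i) χ).symm
    have h2 : normSq ((Gate.H i).act ψ) + normSq ((Gate.H i).act ψ) =
        normSq ψ + normSq ψ := by
      rw [h1, h1]
      refine Finset.sum_congr rfl fun z _ => ?_
      have hs : ‖((√2 : ℝ) : ℂ)⁻¹‖ ^ 2 = 1 / 2 := by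
        rw [norm_inv, Complex.norm_real, Real.norm_of_nonneg (Real.sqrt_nonneg _), inv_pow,
          Real.sq_sqrt (by norm_num)]
        norm_num
      have hp : ∀ a b : ℂ, ‖a - b‖ ^ 2 + ‖a + b‖ ^ 2 = 2 * (‖a‖ ^ 2 + ‖b‖ ^ 2) := by
        intro a b
        have := parallelogram_law_with_norm ℝ a b
        nlinarith
      have hz : flip i z i = !z i := by simp [flip]
      cases hb : z i <;>
        simp only [Gate.act, flip_flip, hz, hb, Bool.not_true, Bool.not_false, if_true,
          Bool.false_eq_true, if_false, norm_mul, mul_pow, hs]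
      · have := hp (ψ z) (ψ (flip i z)); linarith
      · have := hp (ψ (flip i z)) (ψ z); linarith
    linarith
  | T i =>
    refine Finset.sum_congr rfl fun z _ => ?_
    simp only [Gate.act]
    split_ifs
    · rw [norm_mul, Complex.norm_exp_ofReal_mul_I, one_mul]
    · rfl
  | CNOT c t h =>
    have hinv : Function.Involutive (fun z : Qb l => if z c then flip t z else z) := by
      intro z
      have hc : flip t z c = z c := by simp [flip, Function.update_of_ne h]
      by_cases hz : z c <;> simp [hz, hc, flip_flip]
    rw [← normSq_comp _ hinv ψ]
    refine Finset.sum_congr rfl fun z _ => ?_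
    simp only [Gate.act]
    split_ifs <;> rfl

theorem xorMap_involutive {l : ℕ} (O : Oracle len) (Q : Query l) :
    Function.Involutive (Q.xorMap O) := by
  intro z
  have hd := List.disjoint_of_nodup_append Q.nodup
  have hin : Q.inp.map (Q.xorMap O z) = Q.inp.map z := by
    refine List.map_congr_left fun w hw => ?_
    have : w ∉ Q.out := fun h => hd hw h
    simp [Query.xorMap, Query.bit, this]
  funext w
  have hb : Q.bit O (Q.xorMap O z) w = Q.bit O z w := by
    simp only [Query.bit, hin]
  change xor (Q.xorMap O z w) (Q.bit O (Q.xorMap O z) w) = z w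
  rw [hb]
  simp [Query.xorMap]

theorem normSq_query {l : ℕ} (O : Oracle len) (Q : Query l) (ψ : Qb l → ℂ) :
    normSq (Q.act O ψ) = normSq ψ := by
  unfold Query.act
  split_ifs
  · refine Finset.sum_congr rfl fun z _ => ?_
    have h1 : ‖∏ w : Fin l, if z w && Q.bit O z w then (-1 : ℂ) else 1‖ = 1 := by
      rw [norm_prod]
      refine Finset.prod_eq_one fun w _ => ?_
      split_ifs <;> simp
    rw [norm_mul, h1, one_mul]
  · exact normSq_comp _ (xorMap_involutive O Q) ψ

theorem normSq_step {l : ℕ} (O : Oracle len) (s : Step l) (ψ : Qb l → ℂ) :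
    normSq (s.act O ψ) = normSq ψ := by
  have hg : ∀ (gs : List (Gate l)) (χ : Qb l → ℂ),
      normSq (gs.foldl (fun χ g => g.act χ) χ) = normSq χ := by
    intro gs
    induction gs with
    | nil => intro χ; rfl
    | cons g gs ih => intro χ; rw [List.foldl_cons, ih, normSq_gate]
  unfold Step.act
  cases s.query with
  | none => exact hg _ _
  | some Q => exact (normSq_query O Q _).trans (hg _ _)

/-- Pure states of `l` qubits. -/
abbrev State (l : ℕ) := {ψ : Qb l → ℂ // normSq ψ = 1}

/-- The state `|0…0⟩`. -/
def zeroState (l : ℕ) : State l :=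
  ⟨Pi.single (fun _ => false) 1, by
    rw [normSq, Finset.sum_eq_single (fun _ => false)]
    · simp
    · intro z _ hz
      simp [Pi.single_apply, hz]
    · simp⟩

def Step.run {l : ℕ} (O : Oracle len) (s : Step l) (ψ : State l) : State l :=
  ⟨s.act O ψ.1, (normSq_step O s ψ.1).trans ψ.2⟩

/-- Outcome of measuring all qubits in the computational basis. -/
def born {l : ℕ} (ψ : State l) : PMF (Qb l) :=
  PMF.ofFintype (fun z => ENNReal.ofReal (‖ψ.1 z‖ ^ 2)) (by
    rw [← ENNReal.ofReal_sum_of_nonneg (fun _ _ => by positivity)]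
    have := ψ.2
    unfold normSq at this
    rw [this, ENNReal.ofReal_one])

/-- Projection onto the basis states which agree with `z` on the wires in `S`. -/
def project {l : ℕ} (S : List (Fin l)) (z : Qb l) (ψ : Qb l → ℂ) : Qb l → ℂ :=
  fun y => if ∀ w ∈ S, y w = z w then ψ y else 0

open Classical in
/-- The post-measurement state when the wires in `S` are measured in state `ψ` and the outcome is
the restriction of `z` to `S` (for an outcome of probability zero: `ψ`). -/
def collapse {l : ℕ} (S : List (Fin l)) (z : Qb l) (ψ : State l) : State l :=
  if h : 0 < normSq (project S z ψ.1) then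
    ⟨fun y => ((√(normSq (project S z ψ.1)) : ℝ) : ℂ)⁻¹ * project S z ψ.1 y, by
      have h2 : ∀ y, ‖((√(normSq (project S z ψ.1)) : ℝ) : ℂ)⁻¹ * project S z ψ.1 y‖ ^ 2 =
          (normSq (project S z ψ.1))⁻¹ * ‖project S z ψ.1 y‖ ^ 2 := by
        intro y
        rw [norm_mul, mul_pow, norm_inv, Complex.norm_real,
          Real.norm_of_nonneg (Real.sqrt_nonneg _), inv_pow, Real.sq_sqrt h.le]
      change (∑ y, _) = (1 : ℝ)
      rw [Finset.sum_congr rfl fun y _ => h2 y, ← Finset.mul_sum]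
      exact inv_mul_cancel₀ h.ne'⟩
  else ψ

/-- The non-collapsing measurement process started in the state `ψ`: for each step apply `C_i^O`,
measure the wires of `M_i` (this collapses the state; sampling all wires and keeping only the
result on `M_i` gives the right outcome distribution), then sample `v_i` by a
computational-basis measurement of the collapsed state, which is *not* collapsed by this. -/
def process {l : ℕ} (O : Oracle len) : List (Step l) → State l → PMF (List (Qb l))
  | [], _ => PMF.pure []
  | s :: ss, ψ =>
    (born (s.run O ψ)).bind fun z =>
      (born (collapse s.meas z (s.run O ψ))).bind fun v =>
        (process O ss (collapse s.meas z (s.run O ψ))).map fun vs => v :: vs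

/-- The string `v_1 v_2 … v_T`. -/
def flatten {l : ℕ} (vs : List (Qb l)) : List Bool := vs.flatMap List.ofFn

/-- The distribution `DQ^O_C` for the circuit described by the string `C`; the point mass on the
empty string if `C` does not describe a circuit. -/
def DQ (O : Oracle len) (C : List Bool) : PMF (List Bool) :=
  match decode C with
  | none => PMF.pure []
  | some D => (process O D.steps (zeroState D.l)).map flatten

theorem length_process {l : ℕ} (O : Oracle len) (ss : List (Step l)) :
    ∀ (ψ : State l), ∀ vs ∈ (process O ss ψ).support, vs.length = ss.length := by
  induction ss with
  | nil => intro ψ vs h; simp [process] at h; simp [h]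
  | cons s ss ih =>
    intro ψ vs h
    simp only [process, PMF.mem_support_bind_iff, PMF.mem_support_map_iff] at h
    obtain ⟨z, -, v, -, ws, hws, rfl⟩ := h
    simp [ih _ ws hws]

theorem length_DQ (O : Oracle len) (n : ℕ) (C : BStr n) :
    ∀ s ∈ (DQ O C.1).support, s.length ≤ n ^ 2 := by
  intro s hs
  unfold DQ at hs
  cases hd : decode C.1 with
  | none =>
    rw [hd] at hs
    simp at hs
    simp [hs]
  | some D =>
    rw [hd] at hs
    simp only [PMF.mem_support_map_iff] at hs
    obtain ⟨vs, hvs, rfl⟩ := hs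
    have h1 := length_process O D.steps _ vs hvs
    have h2 := size_le_of_decode hd
    have h3 : (flatten vs).length = vs.length * D.l := by
      simp [flatten, List.length_flatMap]
    rw [h3, h1, pow_two]
    exact Nat.mul_le_mul (h2.2.trans C.2) (h2.1.trans C.2)

/-- `DQ^O` on descriptions of length at most `n`; all outcomes have length at most `n ^ 2`. -/
def DQn (O : Oracle len) (n : ℕ) (C : BStr n) : PMF (BStr (n ^ 2)) :=
  (DQ O C.1).bindOnSupport fun s hs => PMF.pure ⟨s, length_DQ O n C s hs⟩

/-! ### Compression unitaries -/

section Compression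

variable {X Y : Type} [Fintype X] [DecidableEq X] [Fintype Y] [DecidableEq Y]

/-- The vector `|D⟩ = ∑ z, √(Pr_D[z]) |z⟩`; the register has the additional basis state `⊥`. -/
def distVec (D : PMF Y) : Option Y → ℂ
  | none => 0
  | some y => ((√((D y).toReal) : ℝ) : ℂ)

/-- The basis vector `|⊥⟩`. -/
def botVec : Option Y → ℂ := Pi.single none 1

/-- `|u⟩⟨v|`. -/
def ketBra {ι : Type} (u v : ι → ℂ) : Matrix ι ι ℂ := Matrix.vecMulVec u (star v)

/-- `U_x = |D_x⟩⟨⊥| + |⊥⟩⟨D_x| + (I - |⊥⟩⟨⊥| - |D_x⟩⟨D_x|)`. -/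
def swapBot (D : PMF Y) : Matrix (Option Y) (Option Y) ℂ :=
  ketBra (distVec D) botVec + ketBra botVec (distVec D) +
    (1 - ketBra botVec botVec - ketBra (distVec D) (distVec D))

/-- `U = ∑ x, |x⟩⟨x| ⊗ U_x`. -/
def compressionMatrix (D : X → PMF Y) : Matrix (X × Option Y) (X × Option Y) ℂ :=
  ∑ x, ketBra (Pi.single x 1) (Pi.single x 1) ⊗ₖ swapBot (D x)

theorem star_distVec (D : PMF Y) : star (distVec D) = distVec D := by
  funext d
  cases d <;> simp [distVec]

theorem star_botVec : star (botVec : Option Y → ℂ) = botVec := by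
  funext d
  cases d <;> simp [botVec]

theorem dist_dot_dist (D : PMF Y) : distVec D ⬝ᵥ distVec D = 1 := by
  have h1 : ∑ y, (D y).toReal = 1 := by
    rw [← ENNReal.toReal_sum (fun y _ => D.apply_ne_top y), ← tsum_fintype (L := .unconditional Y),
      D.tsum_coe, ENNReal.toReal_one]
  simp only [dotProduct, Fintype.sum_option, distVec, mul_zero, zero_add]
  rw [← Complex.ofReal_one, ← h1, Complex.ofReal_sum]
  refine Finset.sum_congr rfl fun y _ => ?_
  rw [← Complex.ofReal_mul, Real.mul_self_sqrt ENNReal.toReal_nonneg]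

theorem bot_dot_bot : (botVec : Option Y → ℂ) ⬝ᵥ botVec = 1 := by
  simp [botVec]

theorem bot_dot_dist (D : PMF Y) : botVec ⬝ᵥ distVec D = 0 := by
  simp [botVec, distVec]

theorem swapBot_star (D : PMF Y) : star (swapBot D) = swapBot D := by
  ext i j
  simp only [swapBot, ketBra, star_distVec, star_botVec, Matrix.star_apply, Matrix.add_apply,
    Matrix.sub_apply, Matrix.vecMulVec_apply, Matrix.one_apply, star_add, star_sub, star_mul']
  have hd : ∀ k, star (distVec D k) = distVec D k := fun k => congrFun (star_distVec D) k
  have hb : ∀ k, star ((botVec : Option Y → ℂ) k) = botVec k := fun k => congrFun star_botVec k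
  simp only [hd, hb, eq_comm (a := j) (b := i)]
  split_ifs <;> simp <;> ring

theorem swapBot_mul_self (D : PMF Y) : swapBot D * swapBot D = 1 := by
  have h1 := dist_dot_dist D
  have h2 := bot_dot_bot (Y := Y)
  have h3 := bot_dot_dist D
  have h4 : distVec D ⬝ᵥ botVec = 0 := by rw [dotProduct_comm]; exact h3
  have hu : swapBot D = 1 - Matrix.vecMulVec (botVec - distVec D) (botVec - distVec D) := by
    simp only [swapBot, ketBra, star_distVec, star_botVec, Matrix.vecMulVec_sub,
      Matrix.sub_vecMulVec]
    abel
  have hn : (botVec - distVec D) ⬝ᵥ (botVec - distVec D) = 2 := by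
    simp only [sub_dotProduct, dotProduct_sub, h1, h2, h3, h4]
    norm_num
  rw [hu]
  simp only [sub_mul, mul_sub, one_mul, mul_one, Matrix.vecMulVec_mul_vecMulVec, hn]
  ext i j
  simp [Matrix.vecMulVec_apply]
  ring

theorem compressionMatrix_apply (D : X → PMF Y) (p r : X × Option Y) :
    compressionMatrix D p r = if p.1 = r.1 then swapBot (D p.1) p.2 r.2 else 0 := by
  rw [compressionMatrix, Matrix.sum_apply, Finset.sum_eq_single p.1]
  · simp [Matrix.kroneckerMap_apply, ketBra, Matrix.vecMulVec_apply, Pi.single_apply,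
      eq_comm (a := r.1)]
  · intro x _ hx
    simp [Matrix.kroneckerMap_apply, ketBra, Matrix.vecMulVec_apply, Pi.single_apply, hx.symm]
  · simp

theorem compressionMatrix_mem (D : X → PMF Y) :
    compressionMatrix D ∈ Matrix.unitaryGroup (X × Option Y) ℂ := by
  have hs : star (compressionMatrix D) = compressionMatrix D := by
    ext p r
    rw [Matrix.star_apply, compressionMatrix_apply, compressionMatrix_apply]
    by_cases h : p.1 = r.1
    · have := congrFun (congrFun (swapBot_star (D p.1)) p.2) r.2
      rw [Matrix.star_apply] at this
      rw [if_pos h, if_pos h.symm, ← h, this]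
    · rw [if_neg h, if_neg (Ne.symm h), star_zero]
  rw [Matrix.mem_unitaryGroup_iff, hs]
  ext p r
  rw [Matrix.mul_apply, Fintype.sum_prod_type, Finset.sum_eq_single p.1]
  · simp only [compressionMatrix_apply, if_true]
    by_cases h : p.1 = r.1
    · have := congrFun (congrFun (swapBot_mul_self (D p.1)) p.2) r.2
      rw [Matrix.mul_apply] at this
      simp only [if_pos h]
      rw [this]
      simp [Matrix.one_apply, Prod.ext_iff, h]
    · simp [h, Matrix.one_apply, Prod.ext_iff]
  · intro x _ hx
    refine Finset.sum_eq_zero fun d _ => ?_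
    simp [compressionMatrix_apply, hx.symm]
  · simp

/-- The compression unitary of the product distribution `⨂ x, D x`, acting on the query register
`X` and the target register `Option Y`, where `none` stands for `⊥`. -/
def compressionUnitary (D : X → PMF Y) : Matrix.unitaryGroup (X × Option Y) ℂ :=
  ⟨compressionMatrix D, compressionMatrix_mem D⟩

end Compression

/-- Registers for queries of length at most `n` to the compression unitary of `DQ^O`. -/
abbrev QReg (n : ℕ) := BStr n × Option (BStr (n ^ 2))

/-- The compression unitary `W^O` for `DQ^O`, on queries of length at most `n`. -/
def WDQ (O : Oracle len) (n : ℕ) : Matrix.unitaryGroup (QReg n) ℂ :=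
  compressionUnitary (DQn O n)

/-! ### Query algorithms and OW2H-compatibility -/

/-- A quantum algorithm making at most `n` queries on the query register `Q`; its workspace is an
arbitrary finite register. -/
structure Adversary (Q : Type) [Fintype Q] [DecidableEq Q] (n : ℕ) where
  Work : Type
  [fintypeWork : Fintype Work]
  [decEqWork : DecidableEq Work]
  init : Q × Work
  queries : ℕ
  queries_le : queries ≤ n
  U : Fin (queries + 1) → Matrix.unitaryGroup (Q × Work) ℂ

attribute [instance] Adversary.fintypeWork Adversary.decEqWork

namespace Adversary

variable {Q : Type} [Fintype Q] [DecidableEq Q] {n : ℕ}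

/-- The `t`-th unitary of the algorithm (the identity after its last one). -/
def unitaryAt (A : Adversary Q n) (t : ℕ) : Matrix (Q × A.Work) (Q × A.Work) ℂ :=
  if h : t < A.queries + 1 then (A.U ⟨t, h⟩).1 else 1

/-- The state just after the `t`-th query (to the unitary `W`) and the unitary following it. -/
def stateAt (A : Adversary Q n) (W : Matrix Q Q ℂ) : ℕ → (Q × A.Work → ℂ)
  | 0 => (A.unitaryAt 0).mulVec (Pi.single A.init 1)
  | t + 1 => (A.unitaryAt (t + 1)).mulVec
      ((W ⊗ₖ (1 : Matrix A.Work A.Work ℂ)).mulVec (A.stateAt W t))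

/-- The purified final state. -/
def final (A : Adversary Q n) (W : Matrix Q Q ℂ) : EuclideanSpace ℂ (Q × A.Work) :=
  WithLp.toLp 2 (A.stateAt W A.queries)

end Adversary

section Compatibility

variable (Q : ℕ → Type) [∀ n, Fintype (Q n)] [∀ n, DecidableEq (Q n)]

/-- Instructions of an algorithm with query access to a family of unitaries `W` (on queries of
length at most `N`) and black-box access to an adversary `A` with query register `Q n`. The
algorithm can act on the query register of `A` and on its own register `Z`, but not on the
workspace of `A`. -/
inductive Instr (n N : ℕ) (Z : Type) [Fintype Z] [DecidableEq Z] where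
  /-- A unitary of its own. -/
  | loc (u : Matrix.unitaryGroup (Q n × Z) ℂ)
  /-- A query to `W` on some subsystem. -/
  | query (m : ℕ) (hm : m ≤ N) (k : ℕ) (e : Q n × Z ≃ Q m × Fin k)
  /-- An application of the `t`-th unitary of `A`. -/
  | call (t : ℕ)

/-- Whether an instruction is a query, to `W` or to `A`. -/
def Instr.isQuery {n N : ℕ} {Z : Type} [Fintype Z] [DecidableEq Z] : Instr Q n N Z → Bool
  | .loc _ => false
  | .query _ _ _ _ => true
  | .call _ => true

/-- An algorithm `B` with query access to a family `W` of unitaries and black-box access to an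
adversary `A` with query register `Q n`. It makes at most `N` queries, of length at most `N`, and
outputs a string of length at most `N`. It draws a uniformly random seed, runs a program, and
measures its register `Z`. -/
structure Extractor (n N : ℕ) where
  Seed : Type
  [fintypeSeed : Fintype Seed]
  [nonemptySeed : Nonempty Seed]
  Z : Type
  [fintypeZ : Fintype Z]
  [decEqZ : DecidableEq Z]
  init : Z
  program : Seed → List (Instr Q n N Z)
  program_le : ∀ r, (program r).countP (Instr.isQuery Q) ≤ N
  output : Seed → Z → BStr N

attribute [instance] Extractor.fintypeSeed Extractor.nonemptySeed Extractor.fintypeZ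
  Extractor.decEqZ

variable {Q}

/-- One instruction, on the joint state of the query register of `A`, the workspace of `A`, and the
register of the algorithm itself. -/
def Instr.exec {n N : ℕ} {Z : Type} [Fintype Z] [DecidableEq Z] (A : Adversary (Q n) n)
    (W : ∀ m, Matrix.unitaryGroup (Q m) ℂ) :
    Instr Q n N Z → (Q n × A.Work × Z → ℂ) → Q n × A.Work × Z → ℂ
  | .loc u, ψ => fun p => (u.1.mulVec fun y => ψ (y.1, p.2.1, y.2)) (p.1, p.2.2)
  | .query m _ k e, ψ => fun p =>
      ((((W m).1 ⊗ₖ (1 : Matrix (Fin k) (Fin k) ℂ)).submatrix e e).mulVec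
        fun y => ψ (y.1, p.2.1, y.2)) (p.1, p.2.2)
  | .call t, ψ => fun p =>
      ((A.unitaryAt t).mulVec fun y => ψ (y.1, y.2, p.2.2)) (p.1, p.2.1)

/-- The final state of `B^{W,A}` for a given seed. -/
def Extractor.final {n N : ℕ} (B : Extractor Q n N) (A : Adversary (Q n) n)
    (W : ∀ m, Matrix.unitaryGroup (Q m) ℂ) (r : B.Seed) : Q n × A.Work × B.Z → ℂ :=
  (B.program r).foldl (fun ψ i => i.exec A W ψ) (Pi.single (A.init.1, A.init.2, B.init) 1)

open Classical in
/-- `Pr[B^{W,A} ∈ T]`. -/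
def Extractor.prob {n N : ℕ} (B : Extractor Q n N) (A : Adversary (Q n) n)
    (W : ∀ m, Matrix.unitaryGroup (Q m) ℂ) (T : Set (List Bool)) : ℝ :=
  (Fintype.card B.Seed : ℝ)⁻¹ *
    ∑ r, ∑ p, if (B.output r p.2.2).1 ∈ T then ‖B.final A W r p‖ ^ 2 else 0

open Classical in
/-- Every `O ∈ 𝕆` can be computed exactly with a single query to `W O`: for all `k` there is a
one-query algorithm which, given an input `x` of length at most `k` in its input register,
outputs `O x` with probability one. -/
def ExactlyComputable (𝕆 : Set (Oracle len))
    (W : Oracle len → ∀ n, Matrix.unitaryGroup (Q n) ℂ) : Prop :=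
  ∀ k : ℕ, ∃ (n d : ℕ) (q₀ : Q n) (w₀ : Fin d)
    (U₀ U₁ : Matrix.unitaryGroup (Q n × BStr k × Fin d) ℂ)
    (output : Q n × BStr k × Fin d → List Bool),
    ∀ O ∈ 𝕆, ∀ x : BStr k,
      (∑ p, if output p = List.ofFn (O x.1) then
        ‖(U₁.1.mulVec (((W O n).1 ⊗ₖ (1 : Matrix (BStr k × Fin d) (BStr k × Fin d) ℂ)).mulVec
          (U₀.1.mulVec (Pi.single (q₀, x, w₀) 1)))) p‖ ^ 2 else 0) = 1

/-- The collection `{W O}_{O ∈ 𝕆}` of unitaries (where `W O n` is the unitary on queries of length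
at most `n`) is OW2H-compatible for `𝕆` with constant `c`. Here `κ` is the security parameter, the
algorithm `B` depends on neither the oracles nor the adversary, and it makes at most
`p(q(κ))` queries. -/
def OW2HCompatible (𝕆 : Set (Oracle len))
    (W : Oracle len → ∀ n, Matrix.unitaryGroup (Q n) ℂ) (c : ℝ) : Prop :=
  ExactlyComputable 𝕆 W ∧
  ∃ p r : Polynomial ℕ, ∀ q : ℕ → ℕ,
    ∃ B : ∀ κ : ℕ, Extractor Q (q κ) (p.eval (q κ)),
      ∀ O ∈ 𝕆, ∀ O' ∈ 𝕆, ∀ A : ∀ κ : ℕ, Adversary (Q (q κ)) (q κ), ∀ κ : ℕ,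
        ‖(A κ).final (W O (q κ)).1 - (A κ).final (W O' (q κ)).1‖ ≤
          ((r.eval (q κ) : ℕ) : ℝ) * ((B κ).prob (A κ) (W O) {x | O x ≠ O' x}) ^ c

end Compatibility

end PDQP

end

/-! Every comparison charges the difference between the oracles to one quantity: the probability, in
the run with O alone, that a measured query input lies in the set where O and O' differ.

Adversary. By the hybrid argument the final states differ by at most the sum over t of ‖(W^O -
W^O')ψ_t‖, where ψ_t are the states of the run with O. Both unitaries are block diagonal in C, and
each block is a reflection 1 - uuᵀ with u = |⊥⟩ - |DQ_C⟩. Hence the blocks differ by at most a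
constant times the distance of the vectors |DQ_C⟩, whose square is the squared Hellinger distance of
the two sample distributions (`normSq_swapBot_sub_le`, `normSq_dist_sub_dist`).

Circuit. The samples v_i are drawn without collapse, so the process is not a measurement of a single
copy of the state, and closeness of states does not pass to the samples by monotonicity alone.
`affinityReal_measureThen_ge` and `affinityReal_process_ge` supply the substitute: for a fixed
oracle, T steps started in ψ and χ have Bhattacharyya coefficient at least 1 - T(1 - Re⟨ψ,χ⟩), so
each additional sample costs only one more multiple of the infidelity. Exchanging the oracles one
step at a time then bounds the squared Hellinger distance by a polynomial times the sum over i of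
the probability that the input of query i, measured in the run with O, lies in the difference set
(`hellingerSq_process_le`).

Extraction. The circuit stopped just before query i has a description that is no longer than the
original one, and the last block of its sample is a measurement of that query input. The algorithm
therefore guesses t and i, runs the adversary up to ψ_t, applies W^O to the truncated description
and |⊥⟩, and measures the result. Its success probability p is exactly the average of the quantities
above (`extractor_prob`). Together this gives a bound of order √p, which implies the one with
exponent 1/4 because p ≤ 1.

Exact computation uses the circuit that writes x, makes one XOR query and measures nothing: its
sample is deterministic, so W^O turns |⊥⟩ into a basis state containing O(x). -/

open scoped ENNReal

namespace PDQP

/-! ### Bhattacharyya coefficient and Hellinger distance -/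

section Affinity

variable {α β : Type}

/-- Cauchy–Schwarz, as Hölder's inequality with exponents 1/2 and 1/2 for the counting measure. -/
theorem tsum_sqrt_mul_le (f g : α → ℝ≥0∞) :
    ∑' a, (f a * g a) ^ (1 / 2 : ℝ) ≤ ((∑' a, f a) * ∑' a, g a) ^ (1 / 2 : ℝ) := by
  let _ : MeasurableSpace α := ⊤
  have h := ENNReal.lintegral_mul_norm_pow_le (μ := MeasureTheory.Measure.count)
    (f := f) (g := g) measurable_from_top.aemeasurable measurable_from_top.aemeasurable
    (p := 1 / 2) (q := 1 / 2) (by norm_num) (by norm_num) (by norm_num)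
  rw [MeasureTheory.lintegral_count, MeasureTheory.lintegral_count,
    MeasureTheory.lintegral_count] at h
  simpa only [ENNReal.mul_rpow_of_nonneg _ _ (by norm_num : (0 : ℝ) ≤ 1 / 2)] using h

/-- The Bhattacharyya coefficient of two distributions. -/
noncomputable def affinity (P Q : PMF α) : ℝ≥0∞ := ∑' a, (P a * Q a) ^ (1 / 2 : ℝ)

theorem affinity_le_one (P Q : PMF α) : affinity P Q ≤ 1 := by
  refine (tsum_sqrt_mul_le _ _).trans ?_
  rw [P.tsum_coe, Q.tsum_coe]
  simp

theorem affinity_ne_top (P Q : PMF α) : affinity P Q ≠ ∞ :=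
  ne_top_of_le_ne_top ENNReal.one_ne_top (affinity_le_one P Q)

theorem sqrt_mul_self (x : ℝ≥0∞) : (x * x) ^ (1 / 2 : ℝ) = x := by
  rw [← pow_two, ← ENNReal.rpow_natCast, ← ENNReal.rpow_mul]
  norm_num

theorem affinity_self (P : PMF α) : affinity P P = 1 := by
  simp only [affinity, sqrt_mul_self, P.tsum_coe]

/-- The left side is the coefficient of the joint distributions of a and b. Forgetting a can only
increase it, by Cauchy–Schwarz in a for each fixed b. Data processing and joint convexity are both
special cases. -/
theorem affinity_bind_ge (P Q : PMF α) (F G : α → PMF β) :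
    ∑' a, (P a * Q a) ^ (1 / 2 : ℝ) * affinity (F a) (G a) ≤
      affinity (P.bind F) (Q.bind G) := by
  have h (a : α) : (P a * Q a) ^ (1 / 2 : ℝ) * affinity (F a) (G a) =
      ∑' b, ((P a * F a b) * (Q a * G a b)) ^ (1 / 2 : ℝ) := by
    rw [affinity, ← ENNReal.tsum_mul_left]
    refine tsum_congr fun b => ?_
    rw [← ENNReal.mul_rpow_of_nonneg _ _ (by norm_num)]
    congr 1
    ring
  simp only [h]
  rw [ENNReal.tsum_comm]
  exact ENNReal.tsum_le_tsum fun b => tsum_sqrt_mul_le _ _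

theorem affinity_map_ge (f : α → β) (P Q : PMF α) :
    affinity P Q ≤ affinity (P.map f) (Q.map f) := by
  refine le_trans (le_of_eq ?_) (affinity_bind_ge P Q (PMF.pure ∘ f) (PMF.pure ∘ f))
  simp [affinity]

/-- The real-valued Bhattacharyya coefficient. -/
noncomputable def affinityReal (P Q : PMF α) : ℝ := (affinity P Q).toReal

theorem affinityReal_nonneg (P Q : PMF α) : 0 ≤ affinityReal P Q := ENNReal.toReal_nonneg

theorem affinityReal_le_one (P Q : PMF α) : affinityReal P Q ≤ 1 :=
  ENNReal.toReal_le_of_le_ofReal zero_le_one (by simpa using affinity_le_one P Q)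

theorem affinityReal_map_ge (f : α → β) (P Q : PMF α) :
    affinityReal P Q ≤ affinityReal (P.map f) (Q.map f) :=
  ENNReal.toReal_mono (affinity_ne_top _ _) (affinity_map_ge f P Q)

theorem toReal_sqrt_mul (x y : ℝ≥0∞) :
    ((x * y) ^ (1 / 2 : ℝ)).toReal = √x.toReal * √y.toReal := by
  rw [← ENNReal.toReal_rpow, ENNReal.toReal_mul, ← Real.sqrt_eq_rpow,
    Real.sqrt_mul ENNReal.toReal_nonneg]

theorem sqrt_mul_ne_top (P Q : PMF α) (a : α) : (P a * Q a) ^ (1 / 2 : ℝ) ≠ ∞ :=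
  ENNReal.rpow_ne_top_of_nonneg (by norm_num)
    (ENNReal.mul_ne_top (P.apply_ne_top a) (Q.apply_ne_top a))

theorem affinityReal_bind_ge [Fintype α] (P Q : PMF α) (F G : α → PMF β) :
    ∑ a, √(P a).toReal * √(Q a).toReal * affinityReal (F a) (G a) ≤
      affinityReal (P.bind F) (Q.bind G) := by
  have h := ENNReal.toReal_mono (affinity_ne_top _ _) (affinity_bind_ge P Q F G)
  rw [tsum_fintype (L := .unconditional α), ENNReal.toReal_sum] at h
  · simpa only [ENNReal.toReal_mul, toReal_sqrt_mul, affinityReal] using h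
  · exact fun a _ => ENNReal.mul_ne_top (sqrt_mul_ne_top P Q a) (affinity_ne_top _ _)

theorem hasSum_affinityReal (P Q : PMF α) :
    HasSum (fun a => √(P a).toReal * √(Q a).toReal) (affinityReal P Q) := by
  have h := ENNReal.hasSum_toReal (f := fun a => (P a * Q a) ^ (1 / 2 : ℝ))
    (affinity_ne_top P Q)
  simp only [toReal_sqrt_mul] at h
  rwa [affinityReal, affinity, ENNReal.tsum_toReal_eq (sqrt_mul_ne_top P Q),
    tsum_congr fun a => toReal_sqrt_mul (P a) (Q a)]

theorem hasSum_toReal (P : PMF α) : HasSum (fun a => (P a).toReal) 1 := by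
  have h := ENNReal.hasSum_toReal (f := P) (by rw [P.tsum_coe]; exact ENNReal.one_ne_top)
  rwa [← ENNReal.tsum_toReal_eq P.apply_ne_top, P.tsum_coe, ENNReal.toReal_one] at h

/-- Squared Hellinger distance, without the factor `1 / 2`. -/
noncomputable def hellingerSq (P Q : PMF α) : ℝ := 2 - 2 * affinityReal P Q

theorem hasSum_hellingerSq (P Q : PMF α) :
    HasSum (fun a => (√(P a).toReal - √(Q a).toReal) ^ 2) (hellingerSq P Q) := by
  have h := ((hasSum_toReal P).add (hasSum_toReal Q)).sub
    ((hasSum_affinityReal P Q).mul_left 2)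
  rw [one_add_one_eq_two] at h
  refine h.congr_fun ?_
  intro a
  rw [sub_sq, Real.sq_sqrt ENNReal.toReal_nonneg, Real.sq_sqrt ENNReal.toReal_nonneg]
  ring

theorem hellingerSq_nonneg (P Q : PMF α) : 0 ≤ hellingerSq P Q := by
  have := affinityReal_le_one P Q
  unfold hellingerSq
  linarith

theorem hellingerSq_self (P : PMF α) : hellingerSq P P = 0 := by
  simp [hellingerSq, affinityReal, affinity_self]

theorem hellingerSq_map_le (f : α → β) (P Q : PMF α) :
    hellingerSq (P.map f) (Q.map f) ≤ hellingerSq P Q := by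
  have := affinityReal_map_ge f P Q
  unfold hellingerSq
  linarith

theorem sum_toReal [Fintype α] (P : PMF α) : ∑ a, (P a).toReal = 1 :=
  (hasSum_fintype _).unique (hasSum_toReal P)

/-- Joint convexity. -/
theorem hellingerSq_bind_le [Fintype α] (P : PMF α) (F G : α → PMF β) :
    hellingerSq (P.bind F) (P.bind G) ≤ ∑ a, (P a).toReal * hellingerSq (F a) (G a) := by
  have h := affinityReal_bind_ge P P F G
  simp only [Real.mul_self_sqrt ENNReal.toReal_nonneg] at h
  simp only [hellingerSq, mul_sub, Finset.sum_sub_distrib, ← Finset.sum_mul, sum_toReal]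
  have h2 : ∑ a, (P a).toReal * (2 * affinityReal (F a) (G a)) =
      2 * ∑ a, (P a).toReal * affinityReal (F a) (G a) := by
    rw [Finset.mul_sum]
    exact Finset.sum_congr rfl fun _ _ => by ring
  linarith

/-- Pointwise (x + y)² ≤ (1 + c)x² + (1 + 1/c)y². The free weight c keeps the constant polynomial
when the inequality is iterated over all steps of a circuit. -/
theorem hellingerSq_triangle (P Q R : PMF α) {c : ℝ} (hc : 0 < c) :
    hellingerSq P R ≤ (1 + c) * hellingerSq P Q + (1 + c⁻¹) * hellingerSq Q R := by
  refine hasSum_le (fun a => ?_) (hasSum_hellingerSq P R)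
    (((hasSum_hellingerSq P Q).mul_left (1 + c)).add
      ((hasSum_hellingerSq Q R).mul_left (1 + c⁻¹)))
  set x := √(P a).toReal - √(Q a).toReal
  set y := √(Q a).toReal - √(R a).toReal
  have h1 : √(P a).toReal - √(R a).toReal = x + y := by simp [x, y]
  have h2 : c⁻¹ * (c * x - y) ^ 2 = c * x ^ 2 - 2 * x * y + c⁻¹ * y ^ 2 := by
    field_simp
    ring
  have h3 : 0 ≤ c⁻¹ * (c * x - y) ^ 2 := by positivity
  rw [h1]
  nlinarith

end Affinity


section Stability

variable {len : List Bool → ℕ} {l : ℕ}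

/-! ### Overlaps of states -/

/-- The real part of the inner product. -/
noncomputable def overlap {ι : Type} [Fintype ι] (ψ χ : ι → ℂ) : ℝ :=
  ∑ z, (star (ψ z) * χ z).re

theorem normSq_sub {ι : Type} [Fintype ι] (ψ χ : ι → ℂ) :
    normSq (fun z => ψ z - χ z) = normSq ψ + normSq χ - 2 * overlap ψ χ := by
  simp only [normSq, overlap, Finset.mul_sum, ← Finset.sum_add_distrib, ← Finset.sum_sub_distrib]
  refine Finset.sum_congr rfl fun z _ => ?_
  simp only [← Complex.normSq_eq_norm_sq, Complex.normSq_apply, Complex.sub_re, Complex.sub_im,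
    Complex.mul_re, Complex.star_def, Complex.conj_re, Complex.conj_im]
  ring

theorem Gate.act_sub (g : Gate l) (ψ χ : Qb l → ℂ) :
    g.act (fun z => ψ z - χ z) = fun z => g.act ψ z - g.act χ z := by
  cases g <;> funext z <;> simp only [Gate.act] <;> split_ifs <;> ring

theorem Query.act_sub (O : Oracle len) (Q : Query l) (ψ χ : Qb l → ℂ) :
    Q.act O (fun z => ψ z - χ z) = fun z => Q.act O ψ z - Q.act O χ z := by
  unfold Query.act
  split_ifs
  · funext z; ring
  · rfl

theorem foldl_act_sub (gs : List (Gate l)) (ψ χ : Qb l → ℂ) :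
    gs.foldl (fun χ g => g.act χ) (fun z => ψ z - χ z) =
      fun z => gs.foldl (fun χ g => g.act χ) ψ z - gs.foldl (fun χ g => g.act χ) χ z := by
  induction gs generalizing ψ χ with
  | nil => rfl
  | cons g gs ih => rw [List.foldl_cons, Gate.act_sub, ih]; rfl

theorem Step.act_sub (O : Oracle len) (s : Step l) (ψ χ : Qb l → ℂ) :
    s.act O (fun z => ψ z - χ z) = fun z => s.act O ψ z - s.act O χ z := by
  obtain ⟨gs, q, m⟩ := s
  unfold Step.act
  cases q with
  | none => exact foldl_act_sub _ _ _
  | some Q => simp only [foldl_act_sub, Query.act_sub]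

/-- By polarization, a norm-preserving map that respects differences preserves the real part of the
inner product. -/
theorem overlap_run (O : Oracle len) (s : Step l) (ψ χ : State l) :
    overlap (s.run O ψ).1 (s.run O χ).1 = overlap ψ.1 χ.1 := by
  have h1 := normSq_sub (s.run O ψ).1 (s.run O χ).1
  have h2 := normSq_sub ψ.1 χ.1
  have h3 := normSq_step O s (fun z => ψ.1 z - χ.1 z)
  rw [Step.act_sub] at h3
  rw [(s.run O ψ).2, (s.run O χ).2] at h1
  rw [ψ.2, χ.2] at h2
  change normSq (fun z => s.act O ψ.1 z - s.act O χ.1 z) = _ at h1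
  linarith

theorem born_toReal (ψ : State l) (z : Qb l) : (born ψ z).toReal = ‖ψ.1 z‖ ^ 2 := by
  rw [born, PMF.ofFintype_apply, ENNReal.toReal_ofReal (by positivity)]

theorem overlap_le_affinityReal_born (ψ χ : State l) :
    overlap ψ.1 χ.1 ≤ affinityReal (born ψ) (born χ) := by
  rw [← (hasSum_fintype _).unique (hasSum_affinityReal (born ψ) (born χ))]
  refine Finset.sum_le_sum fun z _ => ?_
  rw [born_toReal, born_toReal, Real.sqrt_sq (norm_nonneg _), Real.sqrt_sq (norm_nonneg _)]
  refine (Complex.re_le_norm _).trans ?_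
  rw [norm_mul, norm_star]

/-! ### Restricting outcomes to the measured wires -/

/-- Forget the outcome on the wires outside `S`. -/
noncomputable def restrictTo (S : List (Fin l)) (z : Qb l) : Qb l :=
  fun w => if w ∈ S then z w else false

theorem restrictTo_eq_iff (S : List (Fin l)) (y z : Qb l) :
    restrictTo S y = restrictTo S z ↔ ∀ w ∈ S, y w = z w := by
  constructor
  · intro h w hw
    simpa [restrictTo, hw] using congrFun h w
  · intro h
    funext w
    by_cases hw : w ∈ S
    · simpa [restrictTo, hw] using h w hw
    · simp [restrictTo, hw]

theorem restrictTo_idem (S : List (Fin l)) (z : Qb l) :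
    restrictTo S (restrictTo S z) = restrictTo S z := by
  rw [restrictTo_eq_iff]
  intro w hw
  simp [restrictTo, hw]

theorem project_eq_ite (S : List (Fin l)) (z : Qb l) (ψ : Qb l → ℂ) :
    project S z ψ = fun y => if restrictTo S y = restrictTo S z then ψ y else 0 := by
  funext y
  simp only [project, restrictTo_eq_iff]

theorem collapse_restrictTo (S : List (Fin l)) (z : Qb l) (ψ : State l) :
    collapse S (restrictTo S z) ψ = collapse S z ψ := by
  have h : project S (restrictTo S z) ψ.1 = project S z ψ.1 := by
    simp only [project_eq_ite, restrictTo_idem]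
  unfold collapse
  simp only [h]

/-- The component of `ψ` with outcome `c` on the wires in `S`. -/
noncomputable def component (S : List (Fin l)) (ψ : Qb l → ℂ) (c : Qb l) : Qb l → ℂ :=
  fun y => if restrictTo S y = c then ψ y else 0

theorem sum_overlap_component (S : List (Fin l)) (ψ χ : Qb l → ℂ) :
    ∑ c, overlap (component S ψ c) (component S χ c) = overlap ψ χ := by
  unfold overlap
  rw [Finset.sum_comm]
  refine Finset.sum_congr rfl fun z _ => ?_
  rw [Finset.sum_eq_single (restrictTo S z)]
  · simp [component]
  · intro c _ hc
    simp [component, hc.symm]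
  · simp

theorem map_restrictTo_born (S : List (Fin l)) (ψ : State l) (c : Qb l) :
    (((born ψ).map (restrictTo S)) c).toReal = normSq (component S ψ.1 c) := by
  rw [PMF.map_apply, tsum_fintype, ENNReal.toReal_sum]
  · refine Finset.sum_congr rfl fun z _ => ?_
    by_cases h : restrictTo S z = c
    · rw [if_pos h.symm, born_toReal, component, if_pos h]
    · rw [if_neg (Ne.symm h), component, if_neg h]
      simp
  · intro z _
    split_ifs
    · exact PMF.apply_ne_top _ _
    · exact ENNReal.zero_ne_top

theorem collapse_apply_of_pos (S : List (Fin l)) (ψ : State l) (c : Qb l)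
    (h : 0 < normSq (component S ψ.1 c)) (y : Qb l) :
    (collapse S c ψ).1 y =
      ((√(normSq (component S ψ.1 c)) : ℝ) : ℂ)⁻¹ * component S ψ.1 c y := by
  -- If `c` is not already `false` outside `S`, no basis state restricts to `c`, so the component
  -- vanishes, contrary to `h`.
  have hc : restrictTo S c = c := by
    by_contra hne
    refine h.ne' (Finset.sum_eq_zero fun z _ => ?_)
    have hz : restrictTo S z ≠ c := by
      rintro rfl
      exact hne (restrictTo_idem S z)
    simp [component, hz]
  have hp : project S c ψ.1 = component S ψ.1 c := by
    rw [project_eq_ite, hc]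
    rfl
  unfold collapse
  rw [← hp] at h ⊢
  rw [dif_pos h]

theorem normSq_nonneg {ι : Type} [Fintype ι] (ψ : ι → ℂ) : 0 ≤ normSq ψ :=
  Finset.sum_nonneg fun _ _ => by positivity

theorem overlap_eq_zero_of_normSq_left {ι : Type} [Fintype ι] {ψ : ι → ℂ} (χ : ι → ℂ)
    (h : normSq ψ = 0) : overlap ψ χ = 0 := by
  refine Finset.sum_eq_zero fun z _ => ?_
  have := (Finset.sum_eq_zero_iff_of_nonneg fun z _ => by positivity).1 h z (Finset.mem_univ z)
  simp [norm_eq_zero.1 (pow_eq_zero_iff two_ne_zero |>.1 this)]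

theorem overlap_comm {ι : Type} [Fintype ι] (ψ χ : ι → ℂ) : overlap ψ χ = overlap χ ψ := by
  refine Finset.sum_congr rfl fun z _ => ?_
  simp only [Complex.mul_re, Complex.star_def, Complex.conj_re, Complex.conj_im]
  ring

theorem overlap_collapse (S : List (Fin l)) (ψ χ : State l) (c : Qb l)
    (hψ : 0 < normSq (component S ψ.1 c)) (hχ : 0 < normSq (component S χ.1 c)) :
    √(normSq (component S ψ.1 c)) * √(normSq (component S χ.1 c)) *
      overlap (collapse S c ψ).1 (collapse S c χ).1 =
      overlap (component S ψ.1 c) (component S χ.1 c) := by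
  have h1 := Real.sqrt_pos.2 hψ
  have h2 := Real.sqrt_pos.2 hχ
  simp only [overlap, Finset.mul_sum]
  refine Finset.sum_congr rfl fun y _ => ?_
  rw [collapse_apply_of_pos S ψ c hψ, collapse_apply_of_pos S χ c hχ]
  generalize √(normSq (component S ψ.1 c)) = a at *
  generalize √(normSq (component S χ.1 c)) = b at *
  simp only [← Complex.ofReal_inv, Complex.mul_re, Complex.star_def, Complex.conj_re,
    Complex.conj_im, Complex.mul_im, Complex.ofReal_re, Complex.ofReal_im]
  field_simp
  ring

/-! ### Stability of the process under perturbations of the state -/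

/-- The samples produced by a measurement of the wires `S` in the state `φ`, a non-collapsing
measurement, and the remaining steps `ss`. -/
noncomputable def measureThen (O : Oracle len) (ss : List (Step l)) (S : List (Fin l))
    (φ : State l) : PMF (List (Qb l)) :=
  (born φ).bind fun z => (born (collapse S z φ)).bind fun v =>
    (process O ss (collapse S z φ)).map fun vs => v :: vs

theorem process_cons (O : Oracle len) (s : Step l) (ss : List (Step l)) (ψ : State l) :
    process O (s :: ss) ψ = measureThen O ss s.meas (s.run O ψ) := rfl

/-- The collapse depends on `z` only through the wires in `S`. Grouping by the actual outcome `c`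
makes the weights in `affinityReal_bind_ge` equal to √p_c √q_c, exactly the factors lost in
normalizing the collapsed states. -/
theorem measureThen_eq_bind_map (O : Oracle len) (ss : List (Step l)) (S : List (Fin l))
    (φ : State l) : measureThen O ss S φ =
      ((born φ).map (restrictTo S)).bind fun c => (born (collapse S c φ)).bind fun v =>
        (process O ss (collapse S c φ)).map fun vs => v :: vs := by
  rw [PMF.bind_map]
  simp only [measureThen, Function.comp_def, collapse_restrictTo]

theorem affinityReal_sample_ge {α : Type} [Fintype α] (P Q : PMF α) (R R' : PMF (List α)) :
    affinityReal P Q * affinityReal R R' ≤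
      affinityReal (P.bind fun v => R.map fun vs => v :: vs)
        (Q.bind fun v => R'.map fun vs => v :: vs) := by
  refine le_trans ?_ (affinityReal_bind_ge P Q _ _)
  rw [← (hasSum_fintype _).unique (hasSum_affinityReal P Q), Finset.sum_mul]
  exact Finset.sum_le_sum fun v _ =>
    mul_le_mul_of_nonneg_left (affinityReal_map_ge _ R R') (by positivity)

/-- Let r_c = √p_c √q_c, and let x_c be the overlap of the states collapsed to `c`, so that the
overlap of ψ and χ is the sum of r_c x_c. Conditioned on `c`, the immediate sample has coefficient
at least x_c and the remaining T steps at least 1 - T(1 - x_c). Their product is at least (T + 1)x_c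
- T, and this is linear in x_c, so it can be averaged; the r_c sum to at most 1. -/
theorem affinityReal_measureThen_ge (O : Oracle len) (ss : List (Step l))
    (hss : ∀ ψ χ : State l, 1 - ss.length * (1 - overlap ψ.1 χ.1) ≤
      affinityReal (process O ss ψ) (process O ss χ))
    (S : List (Fin l)) (ψ χ : State l) :
    1 - (ss.length + 1) * (1 - overlap ψ.1 χ.1) ≤
      affinityReal (measureThen O ss S ψ) (measureThen O ss S χ) := by
  rw [measureThen_eq_bind_map, measureThen_eq_bind_map]
  refine le_trans ?_ (affinityReal_bind_ge _ _ _ _)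
  set T := (ss.length : ℝ)
  have hT0 : 0 ≤ T := by positivity
  have hR := affinityReal_le_one ((born ψ).map (restrictTo S)) ((born χ).map (restrictTo S))
  rw [← (hasSum_fintype _).unique (hasSum_affinityReal _ _)] at hR
  simp only [map_restrictTo_born] at hR ⊢
  have key : ∀ c, (T + 1) * overlap (component S ψ.1 c) (component S χ.1 c) -
      T * (√(normSq (component S ψ.1 c)) * √(normSq (component S χ.1 c))) ≤
      √(normSq (component S ψ.1 c)) * √(normSq (component S χ.1 c)) *
        affinityReal ((born (collapse S c ψ)).bind fun v =>
            (process O ss (collapse S c ψ)).map fun vs => v :: vs)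
          ((born (collapse S c χ)).bind fun v =>
            (process O ss (collapse S c χ)).map fun vs => v :: vs) := by
    intro c
    -- An outcome of probability zero in either state contributes zero to both sides, so the
    -- arbitrary value of `collapse` there does not matter.
    rcases (normSq_nonneg (component S ψ.1 c)).eq_or_lt with hψ | hψ
    · simp [overlap_eq_zero_of_normSq_left _ hψ.symm, ← hψ]
    rcases (normSq_nonneg (component S χ.1 c)).eq_or_lt with hχ | hχ
    · rw [overlap_comm]
      simp [overlap_eq_zero_of_normSq_left _ hχ.symm, ← hχ]
    rw [← overlap_collapse S ψ χ c hψ hχ]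
    set r := √(normSq (component S ψ.1 c)) * √(normSq (component S χ.1 c))
    have hr : 0 ≤ r := by positivity
    set x := overlap (collapse S c ψ).1 (collapse S c χ).1
    have hA := overlap_le_affinityReal_born (collapse S c ψ) (collapse S c χ)
    have hB := hss (collapse S c ψ) (collapse S c χ)
    have hA0 := affinityReal_nonneg (born (collapse S c ψ)) (born (collapse S c χ))
    have hB0 := affinityReal_nonneg (process O ss (collapse S c ψ))
      (process O ss (collapse S c χ))
    have hAB := affinityReal_sample_ge (born (collapse S c ψ)) (born (collapse S c χ))
      (process O ss (collapse S c ψ)) (process O ss (collapse S c χ))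
    have h1 : (T + 1) * x - T ≤ affinityReal (born (collapse S c ψ)) (born (collapse S c χ)) *
        affinityReal (process O ss (collapse S c ψ)) (process O ss (collapse S c χ)) := by
      rcases le_total 0 x with hx | hx
      · have h2 := mul_le_mul_of_nonneg_right hA hB0
        have h3 := mul_le_mul_of_nonneg_left hB hx
        -- This is the gap: x(1 - T(1 - x)) = (T + 1)x - T + T(1 - x)².
        have h4 : 0 ≤ T * (1 - x) ^ 2 := by positivity
        nlinarith
      · have h2 := mul_nonneg hA0 hB0
        nlinarith
    have h2 := mul_le_mul_of_nonneg_left (h1.trans hAB) hr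
    linarith
  refine le_trans ?_ (Finset.sum_le_sum fun c _ => key c)
  rw [Finset.sum_sub_distrib, ← Finset.mul_sum, ← Finset.mul_sum, sum_overlap_component]
  nlinarith

theorem affinityReal_process_ge (O : Oracle len) (ss : List (Step l)) (ψ χ : State l) :
    1 - ss.length * (1 - overlap ψ.1 χ.1) ≤
      affinityReal (process O ss ψ) (process O ss χ) := by
  induction ss generalizing ψ χ with
  | nil => simp [process, affinityReal, affinity_self]
  | cons s ss ih =>
    have h := affinityReal_measureThen_ge O ss ih s.meas (s.run O ψ) (s.run O χ)
    rw [overlap_run] at h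
    rw [process_cons, process_cons]
    push_cast [List.length_cons]
    exact h

/-- For unit vectors ‖ψ - χ‖² = 2(1 - Re⟨ψ,χ⟩), which matches the factor 2 in `hellingerSq`. -/
theorem hellingerSq_measureThen_le (O : Oracle len) (ss : List (Step l)) (S : List (Fin l))
    (ψ χ : State l) : hellingerSq (measureThen O ss S ψ) (measureThen O ss S χ) ≤
      ((ss.length : ℝ) + 1) * normSq (fun z => ψ.1 z - χ.1 z) := by
  have h := affinityReal_measureThen_ge O ss (affinityReal_process_ge O ss) S ψ χ
  have h2 := normSq_sub ψ.1 χ.1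
  rw [ψ.2, χ.2] at h2
  rw [h2, hellingerSq]
  linarith

end Stability


/-! ### Real-valued probabilities of events -/

section PMFProb

variable {α β : Type}

/-- The probability of an event, as a real number. -/
noncomputable def prob (P : PMF α) (E : Set α) : ℝ := (P.toOuterMeasure E).toReal

theorem toOuterMeasure_le_one (P : PMF α) (E : Set α) : P.toOuterMeasure E ≤ 1 := by
  refine (MeasureTheory.measure_mono (Set.subset_univ E)).trans (le_of_eq ?_)
  exact (P.toOuterMeasure_apply_eq_one_iff _).2 (Set.subset_univ _)

theorem prob_nonneg (P : PMF α) (E : Set α) : 0 ≤ prob P E := ENNReal.toReal_nonneg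

theorem prob_le_one (P : PMF α) (E : Set α) : prob P E ≤ 1 :=
  ENNReal.toReal_le_of_le_ofReal zero_le_one (by simpa using toOuterMeasure_le_one P E)

theorem prob_map (P : PMF α) (f : α → β) (E : Set β) :
    prob (P.map f) E = prob P (f ⁻¹' E) := by
  rw [prob, PMF.toOuterMeasure_map_apply, prob]

theorem prob_bind [Fintype α] (P : PMF α) (F : α → PMF β) (E : Set β) :
    prob (P.bind F) E = ∑ a, (P a).toReal * prob (F a) E := by
  rw [prob, PMF.toOuterMeasure_bind_apply, tsum_fintype, ENNReal.toReal_sum]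
  · simp only [ENNReal.toReal_mul, prob]
  · exact fun a _ => ENNReal.mul_ne_top (P.apply_ne_top a)
      (ne_top_of_le_ne_top ENNReal.one_ne_top (toOuterMeasure_le_one _ _))

open Classical in
theorem prob_eq_sum [Fintype α] (P : PMF α) (E : Set α) :
    prob P E = ∑ a, if a ∈ E then (P a).toReal else 0 := by
  rw [prob, PMF.toOuterMeasure_apply, tsum_fintype, ENNReal.toReal_sum]
  · refine Finset.sum_congr rfl fun a _ => ?_
    by_cases h : a ∈ E <;> simp [h]
  · intro a _
    by_cases h : a ∈ E <;> simp [h, P.apply_ne_top]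

end PMFProb

/-! ### Exchanging the oracle inside a circuit, one step at a time -/

section Hybrid

variable {len : List Bool → ℕ} {l : ℕ}

/-- The first `i` steps, followed by the gates of step `i` only. -/
def truncate : ℕ → List (Step l) → List (Step l)
  | _, [] => []
  | 0, s :: _ => [⟨s.gates, none, []⟩]
  | i + 1, s :: ss => s :: truncate i ss

/-- The query input of step `i`, read off from the block number `i` of the string `x`. -/
def queryInput (i : ℕ) (ss : List (Step l)) (x : List Bool) : List Bool :=
  match ss[i]? with
  | none => []
  | some s => match s.query with
    | none => []
    | some Q => Q.inp.map fun w : Fin l => x.getD (i * l + w) false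

/-- Each sample occupies `l` bits, so removing the first step and the first sample shifts all blocks
by one. -/
theorem queryInput_succ (i : ℕ) (s : Step l) (ss : List (Step l)) (v : Qb l)
    (vs : List (Qb l)) :
    queryInput (i + 1) (s :: ss) (flatten (v :: vs)) = queryInput i ss (flatten vs) := by
  have h (w : Fin l) : (flatten (v :: vs)).getD ((i + 1) * l + w) false =
      (flatten vs).getD (i * l + w) false := by
    rw [flatten, List.flatMap_cons, List.getD_append_right _ _ _ _ (by
      rw [List.length_ofFn]; nlinarith), List.length_ofFn, flatten]
    congr 1
    rw [add_mul, one_mul]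
    omega
  simp only [queryInput, List.getElem?_cons_succ, h]

theorem queryInput_zero (s : Step l) (ss : List (Step l)) (v : Qb l) {Q : Query l}
    (hQ : s.query = some Q) : queryInput 0 (s :: ss) (flatten [v]) = Q.inp.map v := by
  simp only [queryInput, List.getElem?_cons_zero, hQ]
  refine List.map_congr_left fun w _ => ?_
  simp [flatten]

/-- The probability that the input of query `i`, when measured in a run with oracle `O`, is
in `T`. -/
noncomputable def queryProb (O : Oracle len) (T : Set (List Bool)) (i : ℕ) (ss : List (Step l))
    (ψ : State l) : ℝ :=
  prob (process O (truncate i ss) ψ) {vs | queryInput i ss (flatten vs) ∈ T}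

theorem queryProb_nonneg (O : Oracle len) (T : Set (List Bool)) (i : ℕ) (ss : List (Step l))
    (ψ : State l) : 0 ≤ queryProb O T i ss ψ := prob_nonneg _ _

/-- The event reads only the block of step `i + 1`, so the first sample integrates out and only the
average over the collapsing outcome remains. -/
theorem queryProb_succ (O : Oracle len) (T : Set (List Bool)) (i : ℕ) (s : Step l)
    (ss : List (Step l)) (ψ : State l) :
    queryProb O T (i + 1) (s :: ss) ψ =
      ∑ z, (born (s.run O ψ) z).toReal * queryProb O T i ss (collapse s.meas z (s.run O ψ)) := by
  rw [queryProb, truncate, process_cons, measureThen, prob_bind]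
  refine Finset.sum_congr rfl fun z _ => ?_
  congr 1
  rw [prob_bind]
  simp only [prob_map, Set.preimage_ofPred_eq, queryInput_succ]
  rw [← Finset.sum_mul, sum_toReal, one_mul]
  rfl

theorem collapse_nil (z : Qb l) (ψ : State l) : collapse [] z ψ = ψ := by
  have h : project [] z ψ.1 = ψ.1 := by
    funext y
    simp [project]
  have h1 : 0 < normSq (project [] z ψ.1) := by
    rw [h, ψ.2]
    exact one_pos
  unfold collapse
  rw [dif_pos h1]
  ext y
  simp only [h, ψ.2]
  simp

-- With neither query nor collapse in the truncated step, the single sample is a direct measurement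
-- of the state that would enter the query.
open Classical in
theorem queryProb_zero (O : Oracle len) (T : Set (List Bool)) (s : Step l)
    (ss : List (Step l)) (ψ : State l) {Q : Query l} (hQ : s.query = some Q) :
    queryProb O T 0 (s :: ss) ψ =
      ∑ z, if Q.inp.map z ∈ T then ‖s.gates.foldl (fun χ g => g.act χ) ψ.1 z‖ ^ 2 else 0 := by
  rw [queryProb, truncate, process_cons, measureThen, prob_bind]
  simp only [collapse_nil]
  rw [← Finset.sum_mul, sum_toReal, one_mul, prob_bind]
  refine Finset.sum_congr rfl fun v _ => ?_
  rw [process, prob_map, prob, PMF.toOuterMeasure_pure_apply, born_toReal]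
  simp only [Set.preimage_ofPred_eq, Set.mem_ofPred_eq, queryInput_zero s ss v hQ]
  split_ifs
  · rw [ENNReal.toReal_one, mul_one]
    rfl
  · rw [ENNReal.toReal_zero, mul_zero]

theorem ansBit_congr {O O' : Oracle len} {x : List Bool} (h : O x = O' x) (k : ℕ) :
    ansBit O x k = ansBit O' x k := by
  simp only [ansBit, h]

theorem bit_congr {O O' : Oracle len} {Q : Query l} {z : Qb l}
    (h : O (Q.inp.map z) = O' (Q.inp.map z)) : Q.bit O z = Q.bit O' z := by
  funext w
  simp only [Query.bit, ansBit_congr h]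

theorem inp_map_xorMap (O : Oracle len) (Q : Query l) (z : Qb l) :
    Q.inp.map (Q.xorMap O z) = Q.inp.map z := by
  have hd := List.disjoint_of_nodup_append Q.nodup
  refine List.map_congr_left fun w hw => ?_
  have : w ∉ Q.out := fun h => hd hw h
  simp [Query.xorMap, Query.bit, this]

theorem norm_sub_sq_le (a b : ℂ) : ‖a - b‖ ^ 2 ≤ 2 * ‖a‖ ^ 2 + 2 * ‖b‖ ^ 2 := by
  have := parallelogram_law_with_norm ℝ a b
  nlinarith [sq_nonneg ‖a + b‖]

open Classical in
/-- Queries to two oracles differ only on inputs where the oracles differ. -/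
theorem normSq_query_sub_le (O O' : Oracle len) (T : Set (List Bool)) (hT : ∀ x ∉ T, O x = O' x)
    (Q : Query l) (ψ : Qb l → ℂ) :
    normSq (fun z => Q.act O ψ z - Q.act O' ψ z) ≤
      4 * ∑ z, if Q.inp.map z ∈ T then ‖ψ z‖ ^ 2 else 0 := by
  unfold Query.act normSq
  split_ifs
  · rw [Finset.mul_sum]
    refine Finset.sum_le_sum fun z _ => ?_
    by_cases h : Q.inp.map z ∈ T
    · have h1 (P : Oracle len) :
          ‖∏ w : Fin l, if z w && Q.bit P z w then (-1 : ℂ) else 1‖ = 1 := by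
        rw [norm_prod]
        refine Finset.prod_eq_one fun w _ => ?_
        split_ifs <;> simp
      rw [if_pos h]
      refine (norm_sub_sq_le _ _).trans (le_of_eq ?_)
      rw [norm_mul, norm_mul, h1, h1]
      ring
    · simp [bit_congr (hT _ h), h]
  -- An XOR query permutes basis states and fixes the query input, so it preserves the weight on
  -- inputs in `T`, whichever oracle answers.
  · have h1 (P : Oracle len) :
        (∑ z, if Q.inp.map z ∈ T then ‖ψ z‖ ^ 2 else 0) =
          ∑ z, if Q.inp.map z ∈ T then ‖ψ (Q.xorMap P z)‖ ^ 2 else 0 := by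
      rw [← Equiv.sum_comp (xorMap_involutive P Q).toPerm]
      simp only [Function.Involutive.coe_toPerm, inp_map_xorMap]
    have h2 := h1 O
    have h3 := h1 O'
    have h4 : ∀ z, ‖ψ (Q.xorMap O z) - ψ (Q.xorMap O' z)‖ ^ 2 ≤
        2 * (if Q.inp.map z ∈ T then ‖ψ (Q.xorMap O z)‖ ^ 2 else 0) +
        2 * (if Q.inp.map z ∈ T then ‖ψ (Q.xorMap O' z)‖ ^ 2 else 0) := by
      intro z
      by_cases h : Q.inp.map z ∈ T
      · simp only [h, if_true]
        exact norm_sub_sq_le _ _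
      · have hx : Q.xorMap O z = Q.xorMap O' z := by
          funext w
          simp only [Query.xorMap, bit_congr (hT _ h)]
        simp [hx, h]
    refine (Finset.sum_le_sum fun z _ => h4 z).trans (le_of_eq ?_)
    rw [Finset.sum_add_distrib, ← Finset.mul_sum, ← Finset.mul_sum, ← h2, ← h3]
    ring

/-- If the step has no query, both runs agree and only nonnegativity of the right side is used. -/
theorem normSq_run_sub_le (O O' : Oracle len) (s : Step l) (ss : List (Step l)) (ψ : State l) :
    normSq (fun z => (s.run O ψ).1 z - (s.run O' ψ).1 z) ≤
      4 * queryProb O {x | O x ≠ O' x} 0 (s :: ss) ψ := by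
  cases hQ : s.query with
  | none =>
    have h : ∀ P : Oracle len, (s.run P ψ).1 = s.gates.foldl (fun χ g => g.act χ) ψ.1 := by
      intro P
      simp only [Step.run, Step.act, hQ]
    have h0 := queryProb_nonneg O {x | O x ≠ O' x} 0 (s :: ss) ψ
    simpa [h, normSq] using h0
  | some Q =>
    have h : ∀ P : Oracle len,
        (s.run P ψ).1 = Q.act P (s.gates.foldl (fun χ g => g.act χ) ψ.1) := by
      intro P
      simp only [Step.run, Step.act, hQ]
    rw [queryProb_zero O _ s ss ψ hQ, h, h]
    exact normSq_query_sub_le O O' _ (fun x hx => not_not.1 hx) Q _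

theorem hellingerSq_measureThen_le_sum (O O' : Oracle len) (ss : List (Step l))
    (S : List (Fin l)) (φ : State l) :
    hellingerSq (measureThen O ss S φ) (measureThen O' ss S φ) ≤
      ∑ z, (born φ z).toReal * hellingerSq (process O ss (collapse S z φ))
        (process O' ss (collapse S z φ)) := by
  refine (hellingerSq_bind_le _ _ _).trans (Finset.sum_le_sum fun z _ => ?_)
  refine mul_le_mul_of_nonneg_left ?_ ENNReal.toReal_nonneg
  refine (hellingerSq_bind_le _ _ _).trans ?_
  refine (Finset.sum_le_sum fun v _ => mul_le_mul_of_nonneg_left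
    (hellingerSq_map_le _ _ _) ENNReal.toReal_nonneg).trans (le_of_eq ?_)
  rw [← Finset.sum_mul, sum_toReal, one_mul]

/-- The intermediate distribution uses `O` in the first step and `O'` afterwards. Its distance to
the `O` process is an average of inductive bounds for states reached under `O`; its distance to the
`O'` process compares two initial states under the single oracle `O'`. Thus all query probabilities
refer to runs with `O`, which is what the extractor can sample. -/
theorem hellingerSq_process_le (O O' : Oracle len) (N : ℕ) (ss : List (Step l))
    (hN : ss.length ≤ N) (ψ : State l) :
    hellingerSq (process O ss ψ) (process O' ss ψ) ≤
      4 * (ss.length + 1) * N *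
        ∑ i ∈ Finset.range ss.length, queryProb O {x | O x ≠ O' x} i ss ψ := by
  induction ss generalizing ψ with
  | nil => simp [process, hellingerSq_self]
  | cons s ss ih =>
    rw [List.length_cons] at hN
    have hN' : (ss.length : ℝ) + 1 ≤ N := by exact_mod_cast hN
    rw [List.length_cons, Finset.sum_range_succ']
    have hT : (0 : ℝ) < ss.length + 1 := by positivity
    -- The weight c = 1/T, with T = `ss.length + 1`, turns the inductive constant 4TN into (1 +
    -- 1/T)·4TN = 4(T + 1)N; the new step costs (1 + T)·4T, which is at most the same constant since
    -- T ≤ `N`.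
    have h1 := hellingerSq_triangle (process O (s :: ss) ψ)
      (measureThen O' ss s.meas (s.run O ψ)) (process O' (s :: ss) ψ) (inv_pos.2 hT)
    have h2 : hellingerSq (process O (s :: ss) ψ) (measureThen O' ss s.meas (s.run O ψ)) ≤
        4 * (ss.length + 1) * N * ∑ i ∈ Finset.range ss.length,
          queryProb O {x | O x ≠ O' x} (i + 1) (s :: ss) ψ := by
      rw [process_cons]
      refine (hellingerSq_measureThen_le_sum O O' ss s.meas (s.run O ψ)).trans ?_
      refine (Finset.sum_le_sum fun z _ => mul_le_mul_of_nonneg_left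
        (ih (by omega) (collapse s.meas z (s.run O ψ))) ENNReal.toReal_nonneg).trans
        (le_of_eq ?_)
      simp only [queryProb_succ]
      rw [Finset.sum_comm, Finset.mul_sum]
      refine Finset.sum_congr rfl fun z _ => ?_
      rw [← Finset.mul_sum]
      ring
    have h3 : hellingerSq (measureThen O' ss s.meas (s.run O ψ)) (process O' (s :: ss) ψ) ≤
        (ss.length + 1) * (4 * queryProb O {x | O x ≠ O' x} 0 (s :: ss) ψ) := by
      rw [process_cons]
      exact (hellingerSq_measureThen_le O' ss s.meas _ _).trans
        (mul_le_mul_of_nonneg_left (normSq_run_sub_le O O' s ss ψ) hT.le)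
    have h0 := queryProb_nonneg O {x | O x ≠ O' x} 0 (s :: ss) ψ
    generalize (∑ i ∈ Finset.range ss.length,
      queryProb O {x | O x ≠ O' x} (i + 1) (s :: ss) ψ) = A at *
    generalize queryProb O {x | O x ≠ O' x} 0 (s :: ss) ψ = B at *
    push_cast
    generalize (ss.length : ℝ) + 1 = T at *
    rw [inv_inv] at h1
    have h4 := mul_le_mul_of_nonneg_left h2 (by positivity : 0 ≤ 1 + T⁻¹)
    have h5 := mul_le_mul_of_nonneg_left h3 (by positivity : 0 ≤ 1 + T)
    have h6 : (1 + T⁻¹) * (4 * T * N * A) = 4 * (T + 1) * N * A := by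
      field_simp
    have h7 : 4 * (T + 1) * B * T ≤ 4 * (T + 1) * B * N :=
      mul_le_mul_of_nonneg_left hN' (by positivity)
    nlinarith

end Hybrid


/-! ### Truncated descriptions and bounds on their lengths -/

section Strings

variable {len : List Bool → ℕ} {l n : ℕ}

theorem length_encNat (k : ℕ) : (encNat k).length = k + 1 := by
  simp [encNat]

/-- An absent query and an empty list of measured wires each cost one bit, the least possible. -/
theorem length_encStep_gates_le (s : Step l) :
    (encStep ⟨s.gates, none, []⟩).length ≤ (encStep s).length := by
  have h1 : 1 ≤ (encQuery s.query).length := by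
    cases s.query <;> simp [encQuery]
  have h2 : 1 ≤ (encList encWire s.meas).length := by
    simp only [encList, List.length_append, length_encNat]
    omega
  have h3 : (encQuery (none : Option (Query l))).length = 1 := rfl
  have h4 : (encList (encWire (l := l)) []).length = 1 := rfl
  simp only [encStep, List.length_append]
  omega

theorem length_truncate_le (i : ℕ) (ss : List (Step l)) :
    (truncate i ss).length ≤ ss.length ∧
      ((truncate i ss).flatMap encStep).length ≤ (ss.flatMap encStep).length := by
  induction ss generalizing i with
  | nil => simp [truncate]
  | cons s ss ih =>
    cases i with
    | zero =>
      have := length_encStep_gates_le s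
      simp only [truncate, List.length_cons, List.length_nil, List.flatMap_cons,
        List.flatMap_nil, List.append_nil, List.length_append]
      omega
    | succ i =>
      have := ih i
      simp only [truncate, List.length_cons, List.flatMap_cons, List.length_append]
      omega

/-- The circuit that stops before query `i`. -/
def Circuit.truncate (i : ℕ) (D : Circuit) : Circuit := ⟨D.l, PDQP.truncate i D.steps⟩

theorem length_encode_truncate_le (i : ℕ) (D : Circuit) :
    (D.truncate i).encode.length ≤ D.encode.length := by
  have := length_truncate_le i D.steps
  simp only [Circuit.encode, Circuit.truncate, List.length_append, encList, length_encNat]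
  omega

/-- The description of the circuit that stops before query `i`. -/
noncomputable def truncateString (i : ℕ) (C : List Bool) : List Bool :=
  match decode C with
  | none => C
  | some D => (D.truncate i).encode

theorem length_truncateString_le (i : ℕ) (C : List Bool) :
    (truncateString i C).length ≤ C.length := by
  unfold truncateString
  cases h : decode C with
  | none => exact le_rfl
  | some D =>
    have := length_encode_truncate_le i D
    rwa [encode_of_decode h] at this

/-- The input of query `i` of the circuit described by `C`, read off from its sample `x`. -/
noncomputable def stringInput (i : ℕ) (C x : List Bool) : List Bool :=
  match decode C with
  | none => []
  | some D => queryInput i D.steps x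

theorem length_queryInput_le (i : ℕ) (ss : List (Step l)) (x : List Bool) :
    (queryInput i ss x).length ≤ l := by
  unfold queryInput
  cases ss[i]? with
  | none => simp
  | some s =>
    cases h : s.query with
    | none => simp [h]
    | some Q =>
      simp only [h, List.length_map]
      simpa using (List.nodup_append.1 Q.nodup).1.length_le_card

theorem length_stringInput_le (i : ℕ) (C x : List Bool) :
    (stringInput i C x).length ≤ C.length := by
  unfold stringInput
  cases h : decode C with
  | none => simp
  | some D => exact (length_queryInput_le i D.steps x).trans (size_le_of_decode h).1

/-- The probability that the input of query `i` of the circuit described by `C`, when measured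
in a run with oracle `O`, is in `T`. -/
noncomputable def stringQueryProb (O : Oracle len) (T : Set (List Bool)) (i : ℕ)
    (C : List Bool) : ℝ :=
  prob (DQ O (truncateString i C)) {x | stringInput i C x ∈ T}

theorem stringQueryProb_nonneg (O : Oracle len) (T : Set (List Bool)) (i : ℕ)
    (C : List Bool) : 0 ≤ stringQueryProb O T i C := prob_nonneg _ _

theorem stringQueryProb_of_decode (O : Oracle len) (T : Set (List Bool)) (i : ℕ)
    {C : List Bool} {D : Circuit} (h : decode C = some D) :
    stringQueryProb O T i C = queryProb O T i D.steps (zeroState D.l) := by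
  have h1 : truncateString i C = (D.truncate i).encode := by simp [truncateString, h]
  have h2 : ∀ x, stringInput i C x = queryInput i D.steps x := by
    intro x
    simp [stringInput, h]
  unfold stringQueryProb
  simp only [h1, h2, DQ, decode_encode, prob_map]
  rfl

theorem hellingerSq_DQ_le (O O' : Oracle len) (n : ℕ) (C : List Bool) (hC : C.length ≤ n) :
    hellingerSq (DQ O C) (DQ O' C) ≤
      4 * (n + 1) * n *
        ∑ i ∈ Finset.range (n + 1), stringQueryProb O {x | O x ≠ O' x} i C := by
  have h0 : ∀ s, 0 ≤ ∑ i ∈ s, stringQueryProb O {x | O x ≠ O' x} i C :=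
    fun s => Finset.sum_nonneg fun i _ => stringQueryProb_nonneg _ _ _ _
  cases h : decode C with
  | none =>
    have h1 : hellingerSq (DQ O C) (DQ O' C) = 0 := by
      simp [DQ, h, hellingerSq_self]
    rw [h1]
    exact mul_nonneg (by positivity) (h0 _)
  | some D =>
    have hT : D.steps.length ≤ n := (size_le_of_decode h).2.trans hC
    have h1 : hellingerSq (DQ O C) (DQ O' C) ≤
        hellingerSq (process O D.steps (zeroState D.l)) (process O' D.steps (zeroState D.l)) := by
      simp only [DQ, h]
      exact hellingerSq_map_le _ _ _
    refine h1.trans ((hellingerSq_process_le O O' n D.steps hT _).trans ?_)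
    simp only [← stringQueryProb_of_decode O _ _ h]
    refine mul_le_mul ?_ ?_ (h0 _) (by positivity)
    · gcongr
    -- The circuit has at most `n` steps. Padding to the fixed range `n + 1` adds nonnegative terms
    -- and makes the set of guesses for `i` nonempty and independent of the circuit.
    · exact Finset.sum_le_sum_of_subset_of_nonneg (Finset.range_subset_range.2 (by omega))
        fun i _ _ => stringQueryProb_nonneg _ _ _ _

/-- Strings that are too long are sent to the empty string. -/
def toBStr (n : ℕ) (s : List Bool) : BStr n := if h : s.length ≤ n then ⟨s, h⟩ else ⟨[], by simp⟩

/-- A description as a pushforward under a map that does not depend on the oracle, so that data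
processing applies to two oracles at once. -/
theorem DQn_eq_map (O : Oracle len) (n : ℕ) (C : BStr n) :
    DQn O n C = (DQ O C.1).map (toBStr (n ^ 2)) := by
  rw [← PMF.bind_pure_comp, ← PMF.bindOnSupport_eq_bind, DQn]
  congr 1
  funext s hs
  simp [toBStr, length_DQ O n C s hs]

theorem prob_DQn (O : Oracle len) (n : ℕ) (C : BStr n) (E : Set (List Bool)) :
    prob (DQn O n C) {x | x.1 ∈ E} = prob (DQ O C.1) E := by
  rw [DQn_eq_map, prob_map, prob, prob]
  congr 1
  refine PMF.toOuterMeasure_apply_eq_of_inter_support_eq _ ?_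
  ext s
  simp only [Set.mem_inter_iff, Set.mem_preimage, Set.mem_ofPred_eq, and_congr_left_iff]
  intro hs
  simp [toBStr, length_DQ O n C s hs]

theorem hellingerSq_DQn_le (O O' : Oracle len) (n : ℕ) (C : BStr n) :
    hellingerSq (DQn O n C) (DQn O' n C) ≤
      4 * (n + 1) * n *
        ∑ i ∈ Finset.range (n + 1), stringQueryProb O {x | O x ≠ O' x} i C.1 := by
  rw [DQn_eq_map, DQn_eq_map]
  exact (hellingerSq_map_le _ _ _).trans (hellingerSq_DQ_le O O' n C.1 C.2)

end Strings


/-! ### Euclidean norms and unitary matrices -/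

section LinearAlgebra

variable {ι κ : Type} [Fintype ι] [Fintype κ]

theorem norm_dotProduct_sq_le (a b : ι → ℂ) : ‖a ⬝ᵥ b‖ ^ 2 ≤ normSq a * normSq b := by
  have h : ‖a ⬝ᵥ b‖ ≤ ∑ i, ‖a i‖ * ‖b i‖ :=
    (norm_sum_le _ _).trans_eq (Finset.sum_congr rfl fun i _ => norm_mul _ _)
  exact (pow_le_pow_left₀ (norm_nonneg _) h 2).trans (Finset.sum_mul_sq_le_sq_mul_sq _ _ _)

theorem normSq_eq_dotProduct (f : ι → ℂ) : (normSq f : ℂ) = star f ⬝ᵥ f := by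
  simp only [normSq, dotProduct, Complex.ofReal_sum, Pi.star_apply]
  refine Finset.sum_congr rfl fun i _ => ?_
  rw [Complex.star_def, ← Complex.normSq_eq_conj_mul_self, Complex.normSq_eq_norm_sq]

theorem normSq_unitary_mulVec [DecidableEq ι] {U : Matrix ι ι ℂ}
    (hU : U ∈ Matrix.unitaryGroup ι ℂ) (f : ι → ℂ) : normSq (U.mulVec f) = normSq f := by
  have h : (normSq (U.mulVec f) : ℂ) = normSq f := by
    rw [normSq_eq_dotProduct, normSq_eq_dotProduct, Matrix.star_mulVec,
      ← Matrix.dotProduct_mulVec, Matrix.mulVec_mulVec, ← Matrix.star_eq_conjTranspose,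
      Matrix.mem_unitaryGroup_iff'.1 hU, Matrix.one_mulVec]
  exact_mod_cast h

theorem norm_toLp_eq_sqrt (f : ι → ℂ) : ‖WithLp.toLp 2 f‖ = √(normSq f) := by
  rw [EuclideanSpace.norm_eq]
  rfl

theorem sqrt_normSq_add_le (f g : ι → ℂ) :
    √(normSq (f + g)) ≤ √(normSq f) + √(normSq g) := by
  simp only [← norm_toLp_eq_sqrt, WithLp.toLp_add]
  exact norm_add_le _ _

theorem kronecker_one_mulVec [DecidableEq κ] (M : Matrix ι ι ℂ) (ψ : ι × κ → ℂ) (p : ι × κ) :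
    ((M ⊗ₖ (1 : Matrix κ κ ℂ)).mulVec ψ) p = M.mulVec (fun i => ψ (i, p.2)) p.1 := by
  simp only [Matrix.mulVec, dotProduct, Fintype.sum_prod_type, Matrix.kroneckerMap_apply,
    Matrix.one_apply]
  refine Finset.sum_congr rfl fun i _ => ?_
  rw [Finset.sum_eq_single p.2]
  · simp
  · intro k _ hk
    simp [hk.symm]
  · simp

theorem kronecker_one_mem_unitaryGroup [DecidableEq ι] [DecidableEq κ] {M : Matrix ι ι ℂ}
    (hM : M ∈ Matrix.unitaryGroup ι ℂ) :
    M ⊗ₖ (1 : Matrix κ κ ℂ) ∈ Matrix.unitaryGroup (ι × κ) ℂ :=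
  Matrix.kronecker_mem_unitary hM (one_mem _)

end LinearAlgebra

/-! ### Compression unitaries of nearby distributions -/

section Compression

variable {X Y : Type} [Fintype X] [DecidableEq X] [Fintype Y] [DecidableEq Y]

theorem swapBot_mulVec (D : PMF Y) (φ : Option Y → ℂ) (d : Option Y) :
    (swapBot D).mulVec φ d =
      φ d - (botVec d - distVec D d) * ((botVec - distVec D) ⬝ᵥ φ) := by
  have hu : swapBot D = 1 - Matrix.vecMulVec (botVec - distVec D) (botVec - distVec D) := by
    simp only [swapBot, ketBra, star_distVec, star_botVec, Matrix.vecMulVec_sub,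
      Matrix.sub_vecMulVec]
    abel
  rw [hu, Matrix.sub_mulVec, Matrix.one_mulVec, Matrix.vecMulVec_mulVec]
  simp

theorem normSq_bot_sub_dist (D : PMF Y) : normSq (botVec - distVec D) = 2 := by
  simp only [normSq, Fintype.sum_option, Pi.sub_apply, distVec, botVec]
  simp only [Pi.single_eq_same, sub_zero, norm_one, one_pow, ne_eq, reduceCtorEq,
    not_false_eq_true, Pi.single_eq_of_ne, zero_sub, norm_neg, Complex.norm_real,
    Real.norm_of_nonneg (Real.sqrt_nonneg _), Real.sq_sqrt ENNReal.toReal_nonneg, sum_toReal]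
  norm_num

theorem normSq_dist_sub_dist (D D' : PMF Y) :
    normSq (distVec D - distVec D') = hellingerSq D D' := by
  rw [← (hasSum_fintype _).unique (hasSum_hellingerSq D D')]
  simp only [normSq, Fintype.sum_option, Pi.sub_apply, distVec, sub_self, norm_zero,
    ← Complex.ofReal_sub, Complex.norm_real, Real.norm_eq_abs, sq_abs]
  simp

/-- With u = ⊥ - D and u' = ⊥ - D', both of squared norm 2, the difference applied to φ is u'⟨u' -
u, φ⟩ + (u' - u)⟨u, φ⟩. Each term has squared norm at most 2 H² ‖φ‖², and the squared norm of a sum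
is at most twice the sum of the squared norms, whence 8. No conjugation is needed since u and u' are
real. -/
theorem normSq_swapBot_sub_le (D D' : PMF Y) (φ : Option Y → ℂ) :
    normSq ((swapBot D).mulVec φ - (swapBot D').mulVec φ) ≤
      8 * hellingerSq D D' * normSq φ := by
  set u := botVec - distVec D with hu
  set u' := botVec - distVec D' with hu'
  have hv : u' - u = distVec D - distVec D' := by
    rw [hu, hu']
    abel
  have hu_apply : ∀ d, botVec d - distVec D d = u d := fun _ => rfl
  have hu'_apply : ∀ d, botVec d - distVec D' d = u' d := fun _ => rfl
  have h1 : ∀ d, ((swapBot D).mulVec φ - (swapBot D').mulVec φ) d =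
      u' d * ((u' - u) ⬝ᵥ φ) - (-((u' - u) d * (u ⬝ᵥ φ))) := by
    intro d
    simp only [Pi.sub_apply, swapBot_mulVec, ← hu, ← hu', sub_dotProduct, hu_apply, hu'_apply]
    ring
  have h2 := norm_dotProduct_sq_le (u' - u) φ
  have h3 := norm_dotProduct_sq_le u φ
  have h4 : normSq ((swapBot D).mulVec φ - (swapBot D').mulVec φ) ≤
      2 * (normSq u' * ‖(u' - u) ⬝ᵥ φ‖ ^ 2) + 2 * (normSq (u' - u) * ‖u ⬝ᵥ φ‖ ^ 2) := by
    unfold normSq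
    rw [Finset.sum_mul, Finset.sum_mul, Finset.mul_sum, Finset.mul_sum,
      ← Finset.sum_add_distrib]
    refine Finset.sum_le_sum fun d _ => ?_
    rw [h1]
    refine (norm_sub_sq_le _ _).trans (le_of_eq ?_)
    rw [norm_neg, norm_mul, norm_mul]
    ring
  rw [normSq_bot_sub_dist D'] at h4
  rw [normSq_bot_sub_dist D] at h3
  rw [hv, normSq_dist_sub_dist] at h2 h4
  have h0 := hellingerSq_nonneg D D'
  nlinarith [mul_le_mul_of_nonneg_left h3 h0]

theorem compressionMatrix_mulVec (D : X → PMF Y) (f : X × Option Y → ℂ) (p : X × Option Y) :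
    (compressionMatrix D).mulVec f p = (swapBot (D p.1)).mulVec (fun d => f (p.1, d)) p.2 := by
  simp only [Matrix.mulVec, dotProduct, Fintype.sum_prod_type, compressionMatrix_apply]
  rw [Finset.sum_eq_single p.1]
  · simp
  · intro x _ hx
    simp [hx.symm]
  · simp

/-- The probability that the query register of a state contains the query `x`. -/
noncomputable def queryWeight {K : Type} [Fintype K] (ψ : (X × Option Y) × K → ℂ) (x : X) : ℝ :=
  ∑ d, ∑ k, ‖ψ ((x, d), k)‖ ^ 2

theorem queryWeight_nonneg {K : Type} [Fintype K] (ψ : (X × Option Y) × K → ℂ) (x : X) :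
    0 ≤ queryWeight ψ x :=
  Finset.sum_nonneg fun _ _ => Finset.sum_nonneg fun _ _ => by positivity

theorem sum_queryWeight {K : Type} [Fintype K] (ψ : (X × Option Y) × K → ℂ) :
    ∑ x, queryWeight ψ x = normSq ψ := by
  simp only [queryWeight, normSq, Fintype.sum_prod_type]

theorem normSq_compression_sub_le {K : Type} [Fintype K] [DecidableEq K] (D D' : X → PMF Y)
    (ψ : (X × Option Y) × K → ℂ) :
    normSq ((compressionMatrix D ⊗ₖ (1 : Matrix K K ℂ)).mulVec ψ -
      (compressionMatrix D' ⊗ₖ (1 : Matrix K K ℂ)).mulVec ψ) ≤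
      8 * ∑ x, queryWeight ψ x * hellingerSq (D x) (D' x) := by
  have h1 : normSq ((compressionMatrix D ⊗ₖ (1 : Matrix K K ℂ)).mulVec ψ -
      (compressionMatrix D' ⊗ₖ (1 : Matrix K K ℂ)).mulVec ψ) =
      ∑ x, ∑ k, normSq ((swapBot (D x)).mulVec (fun d => ψ ((x, d), k)) -
        (swapBot (D' x)).mulVec (fun d => ψ ((x, d), k))) := by
    simp only [normSq, Fintype.sum_prod_type, Pi.sub_apply, kronecker_one_mulVec,
      compressionMatrix_mulVec]
    exact Finset.sum_congr rfl fun x _ => Finset.sum_comm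
  rw [h1, Finset.mul_sum]
  refine Finset.sum_le_sum fun x _ => ?_
  refine (Finset.sum_le_sum fun k _ => normSq_swapBot_sub_le (D x) (D' x) _).trans
    (le_of_eq ?_)
  rw [← Finset.mul_sum, queryWeight, Finset.sum_comm]
  simp only [normSq]
  ring

end Compression

/-! ### Hybrid argument over the queries of the adversary -/

namespace Adversary

variable {Q : Type} [Fintype Q] [DecidableEq Q] {n : ℕ}

theorem unitaryAt_mem (A : Adversary Q n) (t : ℕ) :
    A.unitaryAt t ∈ Matrix.unitaryGroup (Q × A.Work) ℂ := by
  unfold unitaryAt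
  split_ifs
  · exact (A.U _).2
  · exact one_mem _

theorem normSq_stateAt (A : Adversary Q n) {W : Matrix Q Q ℂ}
    (hW : W ∈ Matrix.unitaryGroup Q ℂ) (t : ℕ) : normSq (A.stateAt W t) = 1 := by
  induction t with
  | zero =>
    rw [stateAt, normSq_unitary_mulVec (A.unitaryAt_mem 0), normSq,
      Finset.sum_eq_single A.init]
    · simp
    · intro q _ hq
      simp [hq]
    · simp
  | succ t ih =>
    rw [stateAt, normSq_unitary_mulVec (A.unitaryAt_mem _),
      normSq_unitary_mulVec (kronecker_one_mem_unitaryGroup hW), ih]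

/-- The hybrid argument. -/
theorem sqrt_normSq_stateAt_sub_le (A : Adversary Q n) (W : Matrix Q Q ℂ) {W' : Matrix Q Q ℂ}
    (hW' : W' ∈ Matrix.unitaryGroup Q ℂ) (t : ℕ) :
    √(normSq (A.stateAt W t - A.stateAt W' t)) ≤
      ∑ s ∈ Finset.range t, √(normSq
        ((W ⊗ₖ (1 : Matrix A.Work A.Work ℂ)).mulVec (A.stateAt W s) -
          (W' ⊗ₖ (1 : Matrix A.Work A.Work ℂ)).mulVec (A.stateAt W s))) := by
  induction t with
  | zero => simp [stateAt, normSq]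
  | succ t ih =>
    rw [stateAt, stateAt, ← Matrix.mulVec_sub, normSq_unitary_mulVec (A.unitaryAt_mem _),
      Finset.sum_range_succ, add_comm]
    have h : (W ⊗ₖ (1 : Matrix A.Work A.Work ℂ)).mulVec (A.stateAt W t) -
        (W' ⊗ₖ (1 : Matrix A.Work A.Work ℂ)).mulVec (A.stateAt W' t) =
        ((W ⊗ₖ (1 : Matrix A.Work A.Work ℂ)).mulVec (A.stateAt W t) -
          (W' ⊗ₖ (1 : Matrix A.Work A.Work ℂ)).mulVec (A.stateAt W t)) +
        (W' ⊗ₖ (1 : Matrix A.Work A.Work ℂ)).mulVec (A.stateAt W t - A.stateAt W' t) := by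
      rw [Matrix.mulVec_sub]
      abel
    rw [h]
    refine (sqrt_normSq_add_le _ _).trans ?_
    rw [normSq_unitary_mulVec (kronecker_one_mem_unitaryGroup hW') (A.stateAt W t - _)]
    gcongr

theorem norm_final_sub_le (A : Adversary Q n) (W : Matrix Q Q ℂ) {W' : Matrix Q Q ℂ}
    (hW' : W' ∈ Matrix.unitaryGroup Q ℂ) :
    ‖A.final W - A.final W'‖ ≤
      ∑ s ∈ Finset.range n, √(normSq
        ((W ⊗ₖ (1 : Matrix A.Work A.Work ℂ)).mulVec (A.stateAt W s) -
          (W' ⊗ₖ (1 : Matrix A.Work A.Work ℂ)).mulVec (A.stateAt W s))) := by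
  rw [final, final, ← WithLp.toLp_sub, norm_toLp_eq_sqrt]
  refine (A.sqrt_normSq_stateAt_sub_le W hW' A.queries).trans ?_
  exact Finset.sum_le_sum_of_subset_of_nonneg
    (Finset.range_subset_range.2 A.queries_le) fun _ _ _ => Real.sqrt_nonneg _

end Adversary

/-- The final states under two oracles, in terms of the query weights. -/
theorem norm_final_WDQ_sub_le {len : List Bool → ℕ} (O O' : Oracle len) {n : ℕ}
    (A : Adversary (QReg n) n) {p : ℝ}
    (hp : ∑ t ∈ Finset.range (n + 1), ∑ i ∈ Finset.range (n + 1),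
      ∑ C : BStr n, queryWeight (A.stateAt (WDQ O n).1 t) C *
        stringQueryProb O {x | O x ≠ O' x} i C.1 = (n + 1) ^ 2 * p) :
    ‖A.final (WDQ O n).1 - A.final (WDQ O' n).1‖ ≤ 6 * (n + 1) ^ 3 * √p := by
  have h0 : ∀ t i, 0 ≤ ∑ C : BStr n, queryWeight (A.stateAt (WDQ O n).1 t) C *
      stringQueryProb O {x | O x ≠ O' x} i C.1 := fun t i =>
    Finset.sum_nonneg fun C _ => mul_nonneg (queryWeight_nonneg _ _)
      (stringQueryProb_nonneg _ _ _ _)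
  have hp0 : 0 ≤ p := by
    have h1 : (0 : ℝ) ≤ (n + 1) ^ 2 * p := by
      rw [← hp]
      exact Finset.sum_nonneg fun t _ => Finset.sum_nonneg fun i _ => h0 t i
    exact nonneg_of_mul_nonneg_right h1 (by positivity)
  have key : ∀ t ∈ Finset.range n, √(normSq
      (((WDQ O n).1 ⊗ₖ (1 : Matrix A.Work A.Work ℂ)).mulVec (A.stateAt (WDQ O n).1 t) -
        ((WDQ O' n).1 ⊗ₖ (1 : Matrix A.Work A.Work ℂ)).mulVec (A.stateAt (WDQ O n).1 t))) ≤
      6 * (n + 1) ^ 2 * √p := by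
    intro t ht
    have h1 := normSq_compression_sub_le (DQn O n) (DQn O' n) (A.stateAt (WDQ O n).1 t)
    have h2 : ∑ C, queryWeight (A.stateAt (WDQ O n).1 t) C *
        hellingerSq (DQn O n C) (DQn O' n C) ≤ 4 * (n + 1) * n * ((n + 1) ^ 2 * p) := by
      have h3 : ∑ C, queryWeight (A.stateAt (WDQ O n).1 t) C *
          hellingerSq (DQn O n C) (DQn O' n C) ≤ 4 * (n + 1) * n *
          ∑ i ∈ Finset.range (n + 1), ∑ C : BStr n, queryWeight (A.stateAt (WDQ O n).1 t) C *
            stringQueryProb O {x | O x ≠ O' x} i C.1 := by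
        refine (Finset.sum_le_sum fun C _ => mul_le_mul_of_nonneg_left
          (hellingerSq_DQn_le O O' n C) (queryWeight_nonneg _ _)).trans (le_of_eq ?_)
        rw [Finset.sum_comm, Finset.mul_sum]
        refine Finset.sum_congr rfl fun C _ => ?_
        rw [← Finset.mul_sum]
        ring
      refine h3.trans (mul_le_mul_of_nonneg_left ?_ (by positivity))
      rw [← hp]
      exact Finset.single_le_sum (f := fun t => ∑ i ∈ Finset.range (n + 1), ∑ C : BStr n,
          queryWeight (A.stateAt (WDQ O n).1 t) C * stringQueryProb O {x | O x ≠ O' x} i C.1)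
        (fun t _ => Finset.sum_nonneg fun i _ => h0 t i)
        (Finset.mem_range.2 ((Finset.mem_range.1 ht).trans (Nat.lt_succ_self n)))
    -- The bound is 8 · 4(n + 1)n · (n + 1)² p ≤ 32(n + 1)⁴ p, and 32 ≤ 6².
    refine Real.sqrt_le_iff.2 ⟨by positivity, h1.trans ?_⟩
    rw [mul_pow, Real.sq_sqrt hp0]
    refine (mul_le_mul_of_nonneg_left h2 (by norm_num)).trans ?_
    have hn : (n : ℝ) ≤ n + 1 := by linarith
    have h4 : (0 : ℝ) ≤ (n + 1) ^ 3 * p := by positivity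
    have h5 := mul_le_mul_of_nonneg_right hn h4
    have h6 : (0 : ℝ) ≤ (n + 1) * ((n + 1) ^ 3 * p) := by positivity
    nlinarith
  refine (A.norm_final_sub_le _ (WDQ O' n).2).trans ((Finset.sum_le_sum key).trans ?_)
  rw [Finset.sum_const, Finset.card_range, nsmul_eq_mul]
  have hs : (0 : ℝ) ≤ 6 * (n + 1) ^ 2 * √p := by positivity
  nlinarith


/-! ### Permutations of basis states as unitaries -/

section Permutation

variable {ι : Type} [Fintype ι] [DecidableEq ι]

theorem permMatrix_mem_unitaryGroup (σ : Equiv.Perm ι) :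
    σ.permMatrix ℂ ∈ Matrix.unitaryGroup ι ℂ := by
  rw [Matrix.mem_unitaryGroup_iff, Matrix.star_eq_conjTranspose, Matrix.conjTranspose_permMatrix,
    ← Matrix.permMatrix_mul, inv_mul_cancel, Matrix.permMatrix_one]

/-- A permutation of the basis states. -/
noncomputable def permUnitary (σ : Equiv.Perm ι) : Matrix.unitaryGroup ι ℂ :=
  ⟨σ.permMatrix ℂ, permMatrix_mem_unitaryGroup σ⟩

theorem permUnitary_mulVec (σ : Equiv.Perm ι) (f : ι → ℂ) :
    (permUnitary σ).1.mulVec f = f ∘ σ :=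
  Matrix.permMatrix_mulVec σ

/-- Apply to the second register a permutation controlled by the first one. -/
def controlledPerm {κ : Type} (σ : ι → Equiv.Perm κ) : Equiv.Perm (ι × κ) :=
  Equiv.prodShear (Equiv.refl ι) σ

theorem controlledPerm_apply {κ : Type} (σ : ι → Equiv.Perm κ) (p : ι × κ) :
    controlledPerm σ p = (p.1, σ p.1 p.2) := rfl

end Permutation

/-! ### Simulating the adversary with black-box access -/

section Exec

variable {Q : ℕ → Type} [∀ n, Fintype (Q n)] [∀ n, DecidableEq (Q n)] {n N : ℕ} {Z : Type}
  [Fintype Z] [DecidableEq Z]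

theorem exec_query (A : Adversary (Q n) n) (W : ∀ m, Matrix.unitaryGroup (Q m) ℂ) (m : ℕ)
    (hm : m ≤ N) (k : ℕ) (e : Q n × Z ≃ Q m × Fin k) (ψ : Q n × A.Work × Z → ℂ)
    (q : Q n) (w : A.Work) (z : Z) :
    (Instr.query m hm k e : Instr Q n N Z).exec A W ψ (q, w, z) =
      (W m).1.mulVec (fun b => ψ ((e.symm (b, (e (q, z)).2)).1, w,
        (e.symm (b, (e (q, z)).2)).2)) (e (q, z)).1 := by
  simp only [Instr.exec, Matrix.submatrix_mulVec_equiv, Function.comp_apply,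
    kronecker_one_mulVec]

/-- A query on the query register of the adversary. -/
noncomputable def adversaryQuery (hn : n ≤ N) : Instr Q n N Z :=
  .query n hn (Fintype.card Z) (Equiv.prodCongr (Equiv.refl _) (Fintype.equivFin Z))

theorem exec_adversaryQuery (A : Adversary (Q n) n) (W : ∀ m, Matrix.unitaryGroup (Q m) ℂ)
    (hn : n ≤ N) (ψ : Q n × A.Work × Z → ℂ) (q : Q n) (w : A.Work) (z : Z) :
    (adversaryQuery hn : Instr Q n N Z).exec A W ψ (q, w, z) =
      (W n).1.mulVec (fun b => ψ (b, w, z)) q := by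
  rw [adversaryQuery, exec_query]
  simp

/-- Run the adversary up to the unitary after its `t`-th query. -/
noncomputable def simulation (Q : ℕ → Type) [∀ n, Fintype (Q n)] [∀ n, DecidableEq (Q n)]
    (Z : Type) [Fintype Z] [DecidableEq Z] (hn : n ≤ N) : ℕ → List (Instr Q n N Z)
  | 0 => [.call 0]
  | t + 1 => simulation Q Z hn t ++ [adversaryQuery hn, .call (t + 1)]

theorem countP_simulation (hn : n ≤ N) (t : ℕ) :
    (simulation Q Z hn t).countP (Instr.isQuery Q) = 2 * t + 1 := by
  induction t with
  | zero => rfl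
  | succ t ih =>
    rw [simulation, List.countP_append, ih]
    rfl

theorem foldl_simulation (A : Adversary (Q n) n) (W : ∀ m, Matrix.unitaryGroup (Q m) ℂ)
    (hn : n ≤ N) (z₀ : Z) (t : ℕ) :
    (simulation Q Z hn t).foldl (fun ψ i => i.exec A W ψ)
        (Pi.single (A.init.1, A.init.2, z₀) 1) =
      fun p => if p.2.2 = z₀ then A.stateAt (W n).1 t (p.1, p.2.1) else 0 := by
  induction t with
  | zero =>
    funext ⟨q, w, z⟩
    simp only [simulation, List.foldl_cons, List.foldl_nil, Instr.exec, Adversary.stateAt]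
    by_cases hz : z = z₀
    · rw [if_pos hz]
      congr 1
      funext y
      simp [Pi.single_apply, Prod.ext_iff, hz]
    · rw [if_neg hz]
      have h : (fun y : Q n × A.Work => (Pi.single (A.init.1, A.init.2, z₀) 1 :
          Q n × A.Work × Z → ℂ) (y.1, y.2, z)) = 0 := by
        funext y
        simp [Prod.ext_iff, hz]
      rw [h, Matrix.mulVec_zero, Pi.zero_apply]
  | succ t ih =>
    rw [simulation, List.foldl_append, ih]
    funext ⟨q, w, z⟩
    simp only [List.foldl_cons, List.foldl_nil]
    rw [Instr.exec]
    simp only [exec_adversaryQuery]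
    by_cases hz : z = z₀
    · simp only [hz, if_true, Adversary.stateAt]
      congr 1
      funext y
      rw [kronecker_one_mulVec]
    · simp only [hz, if_false]
      have h : (fun y : Q n × A.Work => (W n).1.mulVec (fun _ => (0 : ℂ)) y.1) = 0 := by
        funext y
        exact congrFun (Matrix.mulVec_zero _) y.1
      rw [h, Matrix.mulVec_zero, Pi.zero_apply]

end Exec

/-! ### The extractor and its success probability -/

section Extraction

set_option synthInstance.maxSize 1024

variable {len : List Bool → ℕ} {n : ℕ}

theorem swapBot_none {Y : Type} [Fintype Y] [DecidableEq Y] (D : PMF Y) (d : Option Y) :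
    swapBot D d none = distVec D d := by
  cases d <;> simp [swapBot, ketBra, Matrix.vecMulVec_apply, botVec, distVec]

/-- The description of the circuit that stops before query `i`. -/
noncomputable def truncateBStr (i : ℕ) (C : BStr n) : BStr n :=
  ⟨truncateString i C.1, (length_truncateString_le i C.1).trans C.2⟩

/-- The own register of the extractor: a query register and a copy of a circuit description. -/
abbrev ExtractorReg (n : ℕ) := QReg n × BStr n

/-- The initial state of the own register of the extractor. -/
def extractorInit (n : ℕ) : ExtractorReg n := ((⟨[], by simp⟩, none), ⟨[], by simp⟩)

/-- Given the query of the adversary, prepare the query to the circuit truncated at `i`. -/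
noncomputable def prepareQuery (i : ℕ) : Equiv.Perm (QReg n × ExtractorReg n) :=
  open Classical in
  controlledPerm fun q => Equiv.swap (extractorInit n) ((truncateBStr i q.1, none), q.1)

/-- Exchange the query registers of the adversary and of the extractor. -/
noncomputable def extractorQueryEquiv (n : ℕ) :
    QReg n × ExtractorReg n ≃ QReg n × Fin (Fintype.card (QReg n × BStr n)) where
  toFun p := (p.2.1, Fintype.equivFin _ (p.1, p.2.2))
  invFun p := (((Fintype.equivFin _).symm p.2).1, p.1, ((Fintype.equivFin _).symm p.2).2)
  left_inv p := by simp
  right_inv p := by simp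

/-- The input of query `i`, read off from the own register of the extractor. -/
noncomputable def extractorOutput (i : ℕ) (z : ExtractorReg n) : BStr n :=
  match z.1.2 with
  | none => ⟨[], by simp⟩
  | some y => ⟨stringInput i z.2.1 y.1, (length_stringInput_le i _ _).trans z.2.2⟩

/-- Run the adversary up to the unitary after its `t`-th query, then prepare the query to the
circuit truncated at `i`, and make this query. -/
noncomputable def extractorProgram {N : ℕ} (hn : n ≤ N) (t i : ℕ) :
    List (Instr QReg n N (ExtractorReg n)) :=
  simulation QReg (ExtractorReg n) hn t ++
    [.loc (permUnitary (prepareQuery i)), .query n hn _ (extractorQueryEquiv n)]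

theorem countP_extractorProgram {N : ℕ} (hn : n ≤ N) (t i : ℕ) :
    (extractorProgram hn t i).countP (Instr.isQuery QReg) = 2 * t + 2 := by
  rw [extractorProgram, List.countP_append, countP_simulation]
  rfl

/-- The algorithm which runs the adversary up to a random query, and measures the input of a
random query of the circuit queried. -/
noncomputable def extractor (n N : ℕ) (hN : 2 * n + 2 ≤ N) : Extractor QReg n N where
  Seed := Fin (n + 1) × Fin (n + 1)
  Z := ExtractorReg n
  init := extractorInit n
  program r := extractorProgram (by omega) r.1 r.2
  program_le r := by
    rw [countP_extractorProgram]
    omega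
  output r z := ⟨(extractorOutput r.2 z).1, (extractorOutput r.2 z).2.trans (by omega)⟩

/-- The controlled swap moves the own register from its initial value to the truncated query with
target ⊥, and W^O maps ⊥ to the vector |DQ⟩. The copy of the original description is kept because
the output depends on the own register only and must know which wires carry query `i`; the query
register of the adversary is left unchanged. -/
theorem extractor_final (N : ℕ) (hN : 2 * n + 2 ≤ N) (A : Adversary (QReg n) n) (O : Oracle len)
    (r : Fin (n + 1) × Fin (n + 1)) (q : QReg n) (w : A.Work) (z : ExtractorReg n) :
    (extractor n N hN).final A (fun m => WDQ O m) r (q, w, z) =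
      if z.1.1 = truncateBStr r.2 q.1 ∧ z.2 = q.1 then
        A.stateAt (WDQ O n).1 r.1 (q, w) * distVec (DQn O n (truncateBStr r.2 q.1)) z.1.2
      else 0 := by
  change ((extractorProgram (N := N) (by omega) r.1 r.2).foldl
    (fun ψ i => i.exec A (fun m => WDQ O m) ψ)
    (Pi.single (A.init.1, A.init.2, extractorInit n) 1)) (q, w, z) = _
  rw [extractorProgram, List.foldl_append, foldl_simulation, List.foldl_cons, List.foldl_cons, List.foldl_nil,
    exec_query]
  simp only [Instr.exec, permUnitary_mulVec, Function.comp_apply, prepareQuery,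
    controlledPerm_apply, extractorQueryEquiv, Equiv.coe_fn_mk, Equiv.coe_fn_symm_mk,
    Equiv.symm_apply_apply, Equiv.swap_apply_eq_iff, Equiv.swap_apply_left]
  change (compressionMatrix (DQn O n)).mulVec _ z.1 = _
  simp only [Matrix.mulVec, dotProduct, compressionMatrix_apply]
  -- Only the column of the prepared basis state contributes, and its target is ⊥.
  rw [Finset.sum_eq_single (truncateBStr r.2 q.1, none)]
  · by_cases h1 : z.1.1 = truncateBStr r.2 q.1 <;> by_cases h2 : z.2 = q.1 <;>
      simp [h1, h2, swapBot_none, mul_comm]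
  · intro b _ hb
    have h : ¬ ((b, z.2) = ((truncateBStr r.2 q.1, none), q.1)) :=
      fun h => hb (congrArg Prod.fst h)
    rw [if_neg h, mul_zero]
  · simp

/-- For a fixed seed the query register of the adversary stays in place, so different `C` do not
interfere: the probability is the query weight of `C` times the chance that the truncated sample
reveals an input in `T`. There are (n + 1)² seeds. -/
theorem extractor_prob (N : ℕ) (hN : 2 * n + 2 ≤ N) (A : Adversary (QReg n) n) (O : Oracle len)
    (T : Set (List Bool)) :
    ∑ t ∈ Finset.range (n + 1), ∑ i ∈ Finset.range (n + 1),
      ∑ C : BStr n, queryWeight (A.stateAt (WDQ O n).1 t) C * stringQueryProb O T i C.1 =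
    (n + 1) ^ 2 * (extractor n N hN).prob A (fun m => WDQ O m) T := by
  classical
  have hseed : ∀ r : Fin (n + 1) × Fin (n + 1),
      (∑ p, if ((extractor n N hN).output r p.2.2).1 ∈ T then
        ‖(extractor n N hN).final A (fun m => WDQ O m) r p‖ ^ 2 else 0) =
      ∑ C : BStr n, queryWeight (A.stateAt (WDQ O n).1 r.1) C * stringQueryProb O T r.2 C.1 := by
    intro r
    have hinner : ∀ (q : QReg n) (w : A.Work),
        (∑ z : ExtractorReg n, if ((extractor n N hN).output r z).1 ∈ T then
          ‖(extractor n N hN).final A (fun m => WDQ O m) r (q, w, z)‖ ^ 2 else 0) =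
        ‖A.stateAt (WDQ O n).1 r.1 (q, w)‖ ^ 2 * stringQueryProb O T r.2 q.1.1 := by
      intro q w
      have hp := prob_DQn O n (truncateBStr r.2 q.1) {x | stringInput r.2 q.1.1 x ∈ T}
      rw [stringQueryProb]
      change _ = _ * prob (DQ O (truncateBStr r.2 q.1).1) _
      rw [← hp, prob_eq_sum, Fintype.sum_prod_type, Fintype.sum_prod_type,
        Finset.sum_eq_single (truncateBStr r.2 q.1)]
      · rw [Fintype.sum_option, Finset.sum_eq_single q.1]
        · simp only [extractor_final, and_self, if_true, distVec, mul_zero, norm_zero]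
          rw [Finset.mul_sum]
          simp only [ne_eq, OfNat.ofNat_ne_zero, not_false_eq_true, zero_pow, ite_self, zero_add]
          refine Finset.sum_congr rfl fun y _ => ?_
          rw [Finset.sum_eq_single q.1]
          · simp only [and_self, if_true, norm_mul, mul_pow, Complex.norm_real,
              Real.norm_of_nonneg (Real.sqrt_nonneg _), Real.sq_sqrt ENNReal.toReal_nonneg,
              mul_ite, mul_zero]
            rfl
          · intro c _ hc
            simp [hc]
          · simp
        · intro c _ hc
          simp [extractor_final, hc]
        · simp
      · intro b _ hb
        simp [extractor_final, hb]
      · simp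
    have hprod : ∀ F : QReg n × A.Work × ExtractorReg n → ℝ,
        ∑ p, F p = ∑ q, ∑ w, ∑ z, F (q, w, z) := by
      intro F
      simp only [Fintype.sum_prod_type]
    refine (hprod _).trans ((Finset.sum_congr rfl fun q _ => Finset.sum_congr rfl fun w _ =>
      hinner q w).trans ?_)
    simp only [queryWeight, Finset.sum_mul]
    rw [Fintype.sum_prod_type]
  have hcard : (Fintype.card (extractor n N hN).Seed : ℝ) = (n + 1) ^ 2 := by
    change (Fintype.card (Fin (n + 1) × Fin (n + 1)) : ℝ) = _
    simp [pow_two]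
  have hsum : ∀ F : ℕ → ℕ → ℝ, ∑ t ∈ Finset.range (n + 1), ∑ i ∈ Finset.range (n + 1), F t i =
      ∑ r : Fin (n + 1) × Fin (n + 1), F r.1 r.2 := by
    intro F
    simp only [Fintype.sum_prod_type, Finset.sum_range]
  rw [hsum, Extractor.prob, hcard, ← mul_assoc, mul_inv_cancel₀ (by positivity), one_mul]
  refine Finset.sum_congr rfl fun r _ => (hseed r).symm.trans ?_
  exact Finset.sum_congr rfl fun p _ => if_congr Iff.rfl rfl rfl

theorem extractor_prob_le_one (N : ℕ) (hN : 2 * n + 2 ≤ N) (A : Adversary (QReg n) n)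
    (O : Oracle len) (T : Set (List Bool)) :
    (extractor n N hN).prob A (fun m => WDQ O m) T ≤ 1 := by
  have h := extractor_prob N hN A O T
  have h1 : ∀ t ∈ Finset.range (n + 1), ∀ i ∈ Finset.range (n + 1),
      ∑ C : BStr n, queryWeight (A.stateAt (WDQ O n).1 t) C * stringQueryProb O T i C.1 ≤ 1 := by
    intro t _ i _
    refine (Finset.sum_le_sum fun C _ => mul_le_mul_of_nonneg_left (prob_le_one _ _)
      (queryWeight_nonneg _ _)).trans (le_of_eq ?_)
    simp only [mul_one, sum_queryWeight]
    exact A.normSq_stateAt (WDQ O n).2 t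
  have h2 := Finset.sum_le_sum fun t ht => Finset.sum_le_sum (h1 t ht)
  simp only [Finset.sum_const, Finset.card_range, nsmul_eq_mul, mul_one] at h2
  rw [h] at h2
  push_cast at h2
  have h3 : (0 : ℝ) < (n + 1) ^ 2 := by positivity
  nlinarith

theorem extractor_prob_nonneg (N : ℕ) (hN : 2 * n + 2 ≤ N) (A : Adversary (QReg n) n)
    (O : Oracle len) (T : Set (List Bool)) :
    0 ≤ (extractor n N hN).prob A (fun m => WDQ O m) T :=
  mul_nonneg (by positivity) (Finset.sum_nonneg fun _ _ => Finset.sum_nonneg fun _ _ => by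
    split_ifs <;> positivity)

theorem norm_final_sub_le_prob (N : ℕ) (hN : 2 * n + 2 ≤ N) (A : Adversary (QReg n) n)
    (O O' : Oracle len) :
    ‖A.final (WDQ O n).1 - A.final (WDQ O' n).1‖ ≤ 6 * (n + 1) ^ 3 *
      ((extractor n N hN).prob A (fun m => WDQ O m) {x | O x ≠ O' x}) ^ (1 / 4 : ℝ) := by
  refine (norm_final_WDQ_sub_le O O' A (extractor_prob N hN A O _)).trans ?_
  -- The exponent 1/2 may be lowered to 1/4 because the base lies in [0, 1].
  rw [Real.sqrt_eq_rpow]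
  exact mul_le_mul_of_nonneg_left (Real.rpow_le_rpow_of_exponent_ge'
    (extractor_prob_nonneg N hN A O _) (extractor_prob_le_one N hN A O _) (by norm_num)
    (by norm_num)) (by positivity)

end Extraction


/-! ### Computing the oracle with one query -/

section ExactComputation

variable {len : List Bool → ℕ} {l : ℕ}

theorem flip_eq_iff (i : Fin l) (y z : Qb l) : flip i y = z ↔ y = flip i z := by
  constructor
  · rintro rfl
    rw [flip_flip]
  · rintro rfl
    rw [flip_flip]

theorem act_X_single (i : Fin l) (z : Qb l) :
    (Gate.X i).act (Pi.single z 1) = Pi.single (flip i z) 1 := by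
  funext y
  simp only [Gate.act, Pi.single_apply, flip_eq_iff]

theorem foldl_X_single (L : List (Fin l)) (hL : L.Nodup) (z : Qb l) :
    (L.map Gate.X).foldl (fun χ g => g.act χ) (Pi.single z 1) =
      Pi.single (fun w => xor (z w) (decide (w ∈ L))) 1 := by
  induction L generalizing z with
  | nil => simp
  | cons i L ih =>
    obtain ⟨hi, hL⟩ := List.nodup_cons.1 hL
    rw [List.map_cons, List.foldl_cons, act_X_single, ih hL]
    congr 1
    funext w
    by_cases hw : w = i
    · subst hw
      simp [flip, hi]
    · simp [flip, hw]

/-- Gates preparing the basis state `z`. -/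
noncomputable def prepareGates (z : Qb l) : List (Gate l) :=
  (Finset.univ.filter fun w => z w = true).toList.map Gate.X

theorem foldl_prepareGates (z : Qb l) :
    (prepareGates z).foldl (fun χ g => g.act χ) (zeroState l).1 = Pi.single z 1 := by
  rw [zeroState, prepareGates, foldl_X_single _ (Finset.nodup_toList _)]
  congr 1
  funext w
  simp

theorem act_xor_single (O : Oracle len) (Q : Query l) (hQ : Q.phase = false) (z : Qb l) :
    Q.act O (Pi.single z 1) = Pi.single (Q.xorMap O z) 1 := by
  funext y
  have h : Q.xorMap O y = z ↔ y = Q.xorMap O z := by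
    constructor
    · rintro rfl
      rw [xorMap_involutive O Q y]
    · rintro rfl
      rw [xorMap_involutive O Q z]
  simp [Query.act, hQ, Pi.single_apply, h]

theorem born_of_single (ψ : State l) (z : Qb l) (h : ψ.1 = Pi.single z 1) :
    born ψ = PMF.pure z := by
  ext y
  rw [born, PMF.ofFintype_apply, h, PMF.pure_apply, Pi.single_apply]
  split_ifs <;> simp

/-- The query with input in the first `a` wires and response in the other `b` wires. -/
def splitQuery (a b : ℕ) : Query (a + b) where
  phase := false
  inp := List.ofFn (Fin.castAdd b)
  out := List.ofFn (Fin.natAdd a)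
  nodup := by
    refine List.nodup_append.2 ⟨List.nodup_ofFn.2 (Fin.castAdd_injective a b),
      List.nodup_ofFn.2 (Fin.natAdd_injective b a), ?_⟩
    intro u hu v hv huv
    rw [List.mem_ofFn] at hu hv
    obtain ⟨i, rfl⟩ := hu
    obtain ⟨j, rfl⟩ := hv
    have := congrArg Fin.val huv
    simp only [Fin.val_castAdd, Fin.val_natAdd] at this
    omega

/-- The basis state `|x⟩|0…0⟩`. -/
def inputState (x : List Bool) (b : ℕ) : Qb (x.length + b) := Fin.append x.get fun _ => false

/-- The circuit that queries the oracle on `x`. -/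
noncomputable def queryCircuit (len : List Bool → ℕ) (x : List Bool) : Circuit :=
  ⟨x.length + len x,
    [⟨prepareGates (inputState x (len x)), some (splitQuery x.length (len x)), []⟩]⟩

theorem inp_map_inputState (x : List Bool) (b : ℕ) :
    (splitQuery x.length b).inp.map (inputState x b) = x := by
  rw [splitQuery, List.map_ofFn]
  have h : inputState x b ∘ Fin.castAdd b = x.get := by
    funext i
    simp [inputState]
  rw [h, List.ofFn_get]

/-- The response register starts at zero and has exactly `len x` wires, so the XOR writes the whole
answer after the bits of `x`, without truncation or padding. -/
theorem drop_xorMap_inputState (O : Oracle len) (x : List Bool) :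
    (List.ofFn ((splitQuery x.length (len x)).xorMap O (inputState x (len x)))).drop x.length =
      List.ofFn (O x) := by
  rw [List.ofFn_add, List.drop_left' (by simp)]
  congr 1
  funext j
  have hmem : Fin.natAdd x.length j ∈ (splitQuery x.length (len x)).out := by
    simp [splitQuery]
  have hidx : (splitQuery x.length (len x)).out.idxOf (Fin.natAdd x.length j) = j := by
    have hd : (List.ofFn (Fin.natAdd (m := len x) x.length)).Nodup :=
      List.nodup_ofFn.2 (Fin.natAdd_injective _ _)
    have h := List.Nodup.idxOf_getElem hd j (by simp)
    rwa [List.getElem_ofFn] at h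
  have hz : inputState x (len x) (Fin.natAdd x.length j) = false := by
    simp [inputState]
  rw [Query.xorMap, Query.bit, if_pos hmem, hidx, inp_map_inputState, hz, ansBit, dif_pos j.2,
    Bool.false_xor]

theorem DQ_queryCircuit (O : Oracle len) (x : List Bool) :
    DQ O (queryCircuit len x).encode =
      PMF.pure (List.ofFn ((splitQuery x.length (len x)).xorMap O (inputState x (len x)))) := by
  have hrun : ∀ s : Step (x.length + len x),
      s = ⟨prepareGates (inputState x (len x)), some (splitQuery x.length (len x)), []⟩ →
      born (s.run O (zeroState _)) =
        PMF.pure ((splitQuery x.length (len x)).xorMap O (inputState x (len x))) := by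
    rintro s rfl
    refine born_of_single _ _ ?_
    simp only [Step.run, Step.act, foldl_prepareGates]
    exact act_xor_single O _ rfl _
  rw [DQ, decode_encode]
  simp only [queryCircuit, process, collapse_nil, hrun _ rfl, PMF.pure_bind, PMF.pure_map]
  simp [flatten]

/-- For a point mass, |DQ⟩ is itself a basis vector, so measuring the image of ⊥ is deterministic.
-/
theorem compressionMatrix_pure {X Y : Type} [Fintype X] [DecidableEq X] [Fintype Y]
    [DecidableEq Y] (D : X → PMF Y) (x : X) (y : Y) (h : D x = PMF.pure y) :
    (compressionMatrix D).mulVec (Pi.single (x, none) 1) = Pi.single (x, some y) 1 := by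
  funext ⟨x', d⟩
  rw [compressionMatrix_mulVec]
  by_cases hx : x' = x
  · subst hx
    have h1 : (fun d : Option Y => (Pi.single (x', none) 1 : X × Option Y → ℂ) (x', d)) =
        Pi.single none 1 := by
      funext d
      simp [Pi.single_apply]
    rw [h1, Matrix.mulVec_single_one, Matrix.col_apply, swapBot_none, h]
    cases d with
    | none => simp [distVec]
    | some y' => by_cases hy : y' = y <;> simp [distVec, hy]
  · have h1 : (fun d : Option Y => (Pi.single (x, none) 1 : X × Option Y → ℂ) (x', d)) = 0 := by
      funext d
      simp [hx]
    rw [h1, Matrix.mulVec_zero]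
    simp [hx]

/-- The sample contained in the target register, without the first bits. -/
def sampleAfter {n : ℕ} (a : ℕ) (d : Option (BStr (n ^ 2))) : List Bool :=
  match d with
  | none => []
  | some y => y.1.drop a

theorem exactlyComputable_WDQ (len : List Bool → ℕ) (𝕆 : Set (Oracle len)) :
    ExactlyComputable (Q := QReg) 𝕆 fun O n => WDQ O n := by
  classical
  intro k
  -- One query length for all inputs of length at most `k`; it depends on the interface but on no
  -- oracle.
  set n := Finset.univ.sup fun x : BStr k => (queryCircuit len x.1).encode.length
  have hn : ∀ x : BStr k, (queryCircuit len x.1).encode.length ≤ n := fun x =>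
    Finset.le_sup (f := fun x : BStr k => (queryCircuit len x.1).encode.length)
      (Finset.mem_univ x)
  let q₀ : QReg n := (⟨[], by simp⟩, none)
  let c (x : BStr k) : BStr n := ⟨(queryCircuit len x.1).encode, hn x⟩
  -- Controlled on the input, a swap loads the description of its query circuit, with target ⊥;
  -- being a swap, it is a permutation even if different inputs were to load the same value.
  let σ : Equiv.Perm (QReg n × BStr k × Fin 1) :=
    (Equiv.prodComm _ _).trans ((controlledPerm fun p : BStr k × Fin 1 =>
      Equiv.swap q₀ (c p.1, none)).trans (Equiv.prodComm _ _))
  refine ⟨n, 1, q₀, 0, permUnitary σ, 1, fun p => sampleAfter p.2.1.1.length p.1.2, ?_⟩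
  intro O _ x
  have hlen : ∀ y ∈ (DQ O (c x).1).support, y.length ≤ n ^ 2 := length_DQ O n (c x)
  have hDQ : DQ O (c x).1 = _ := DQ_queryCircuit O x.1
  set y := List.ofFn ((splitQuery x.1.length (len x.1)).xorMap O (inputState x.1 (len x.1)))
    with hy
  have hyn : y.length ≤ n ^ 2 := hlen y (by rw [hDQ]; simp)
  have hD : DQn O n (c x) = PMF.pure ⟨y, hyn⟩ := by
    rw [DQn_eq_map, hDQ, PMF.pure_map, toBStr, dif_pos hyn]
  have h0 : (permUnitary σ).1.mulVec (Pi.single (q₀, x, (0 : Fin 1)) 1) =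
      Pi.single ((c x, none), x, 0) 1 := by
    rw [permUnitary_mulVec]
    funext ⟨q, x', w⟩
    have h : σ (q, x', w) = (q₀, x, 0) ↔ (q, x', w) = ((c x, none), x, 0) := by
      simp only [σ, Equiv.trans_apply, Equiv.prodComm_apply, Prod.swap_prod_mk,
        controlledPerm_apply, Prod.mk.injEq, Equiv.swap_apply_eq_iff, Equiv.swap_apply_left]
      constructor
      · rintro ⟨h1, rfl, h3⟩
        exact ⟨h1, rfl, h3⟩
      · rintro ⟨h1, rfl, h3⟩
        exact ⟨h1, rfl, h3⟩
    simp only [Function.comp_apply, Pi.single_apply, h]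
  have h1 : ((WDQ O n).1 ⊗ₖ (1 : Matrix (BStr k × Fin 1) (BStr k × Fin 1) ℂ)).mulVec
      (Pi.single ((c x, none), x, 0) 1) = Pi.single ((c x, some ⟨y, hyn⟩), x, 0) 1 := by
    funext ⟨q, p⟩
    rw [kronecker_one_mulVec]
    by_cases hp : p = (x, 0)
    · subst hp
      have h2 : (fun i => (Pi.single ((c x, none), x, (0 : Fin 1)) 1 :
          QReg n × BStr k × Fin 1 → ℂ) (i, x, 0)) = Pi.single (c x, none) 1 := by
        funext i
        simp [Pi.single_apply]
      change (compressionMatrix (DQn O n)).mulVec _ q = _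
      rw [h2, compressionMatrix_pure _ _ _ hD]
      simp [Pi.single_apply]
    · have h2 : (fun i => (Pi.single ((c x, none), x, (0 : Fin 1)) 1 :
          QReg n × BStr k × Fin 1 → ℂ) (i, p)) = 0 := by
        funext i
        simp [hp]
      rw [h2, Matrix.mulVec_zero]
      simp [hp]
  rw [h0, h1]
  simp only [OneMemClass.coe_one, Matrix.one_mulVec]
  rw [Finset.sum_eq_single ((c x, some ⟨y, hyn⟩), x, 0)]
  · rw [if_pos]
    · simp
    · exact drop_xorMap_inputState O x.1
  · intro p _ hp
    simp [hp]
  · simp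

end ExactComputation

end PDQP

theorem mainTheorem9 (len : List Bool → ℕ) (𝕆 : Set (PDQP.Oracle len)) :
    PDQP.OW2HCompatible (Q := PDQP.QReg) 𝕆 (fun O n => PDQP.WDQ O n) (1 / 4) := by
  -- Reaching the state after `t ≤ n` queries takes `t + 1` calls and `t` queries, and extraction
  -- takes one more query, so 2n + 2 suffice. The factor 6(n + 1)³ is the one of
  -- `norm_final_sub_le_prob`.
  refine ⟨PDQP.exactlyComputable_WDQ len 𝕆, 2 * Polynomial.X + 2, 6 * (Polynomial.X + 1) ^ 3, ?_⟩
  intro q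
  have h (κ : ℕ) : 2 * q κ + 2 ≤ (2 * Polynomial.X + 2 : Polynomial ℕ).eval (q κ) := by simp
  refine ⟨fun κ => PDQP.extractor (q κ) _ (h κ), ?_⟩
  intro O _ O' _ A κ
  refine (PDQP.norm_final_sub_le_prob _ (h κ) (A κ) O O').trans (le_of_eq ?_)
  simp
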